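/- All matroids have finite ground sets. A matroid is connected if every two distinct elements of its ground set lie in a common circuit, and uniform if, for some $k$, its independent sets are exactly the subsets of the ground set with at most $k$ elements. A flat $F$ of a matroid $M$ with rank function $r$ is proper if $0<r(F)<r(M)$. A set is cyclic if it is a (possibly empty) union of circuits. A polytope is the convex hull of a finite set of points; its faces include the empty set and the polytope itself, and a facet is a maximal face different from the polytope. A split of a polytope $P$ is a collection $\mathcal{C}$ of polytopes such that: (i) $\emptyset\in\mathcal{C}$; (ii) all vertices of each $Q\in\mathcal{C}$ are vertices of $P$; (iii) all faces of each $Q\in\mathcal{C}$ are in $\mathcal{C}$; (iv) the intersection of any two distinct $Q_1,Q_2\in\mathcal{C}$ is a face of both; (v) $\bigcup_{Q\in\mathcal{C}}Q=P$; and (vi) $\mathcal{C}$ has exactly two inclusion-maximal members. The affine span of the intersection of these two maximal members is called a split hyperplane of $P$. Let $M$ be a matroid of rank $r(M)$ with ground set $E$. Let $P(M)\subseteq\mathbb{R}^{E}$ be the convex hull of the characteristic vectors of the bases of $M$, and let $\Delta\subseteq\mathbb{R}^{E}$ be the hypersimplex, that is, the convex hull of all $0,1$-vectors with exactly $r(M)$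 ones. For a flat $F$ let $H(F)=\{x\in\mathbb{R}^{E} : \sum_{i\in F}x_i=r(F)\}$. A flat $F$ is a flacet of $M$ if $H(F)\cap P(M)$ is a facet of $P(M)$ and no flat $G\subsetneq F$ satisfies $H(G)\cap P(M)=H(F)\cap P(M)$; it is a split flacet if, in addition, the affine span of $H(F)\cap\Delta$ is a split hyperplane of $\Delta$. Let $A$ be the affine span of $P(M)$. The matroid $M$ is split if, for any two distinct split flacets $F_1,F_2$ of $M$, no point of $H(F_1)\cap H(F_2)$ is in the relative interior of $A\cap[0,1]^{E}$. **Corollary.** Let $M$ be a connected matroid. Then $M$ is split if and only if, for every $M'\in\{M,M^{*}\}$ and every proper cyclic flat $Z$ of $M'$, if the restriction $M'|Z$ is connected, then it is uniform. -/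

import Mathlib

/-! ### Polytopes and their splits

The faces of a polytope `P` (the empty set, `P` itself, and the intersections of `P` with supporting
hyperplanes) are the sets `F` with `IsExposed ℝ P F`; the vertices are the points of
`P.extremePoints ℝ`. -/

section Polytope

variable {V : Type*} [AddCommGroup V] [Module ℝ V] [TopologicalSpace V]

/-- A polytope is the convex hull of a finite (possibly empty) set of points. -/
def IsPolytope (P : Set V) : Prop :=
  ∃ X : Set V, X.Finite ∧ P = convexHull ℝ X

/-- A facet of `P` is a face other than `P` such that the only face properly containing it
is `P`. -/
def IsFacetOf (P F : Set V) : Prop :=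
  IsExposed ℝ P F ∧ F ≠ P ∧ ∀ G : Set V, IsExposed ℝ P G → F ⊂ G → G = P

/-- `C` is a split of the polytope `P`: a polyhedral subdivision of `P` that uses no new vertices
and has exactly two maximal cells. -/
structure IsSplitOf (P : Set V) (C : Set (Set V)) : Prop where
  isPolytope : ∀ Q ∈ C, IsPolytope Q
  empty_mem : ∅ ∈ C
  vertices_subset : ∀ Q ∈ C, Q.extremePoints ℝ ⊆ P.extremePoints ℝ
  face_mem : ∀ Q ∈ C, ∀ F : Set V, IsExposed ℝ Q F → F ∈ C
  inter_face : ∀ Q₁ ∈ C, ∀ Q₂ ∈ C, Q₁ ≠ Q₂ →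
    IsExposed ℝ Q₁ (Q₁ ∩ Q₂) ∧ IsExposed ℝ Q₂ (Q₁ ∩ Q₂)
  sUnion_eq : ⋃₀ C = P
  two_maximal : {Q : Set V | Maximal (fun R => R ∈ C) Q}.ncard = 2

/-- `H` is a split hyperplane of `P`: the affine span of the intersection of the two maximal cells
of some split of `P`. -/
def IsSplitHyperplane (P : Set V) (H : AffineSubspace ℝ V) : Prop :=
  ∃ C : Set (Set V), IsSplitOf P C ∧ ∃ Q₁ Q₂ : Set V,
    Maximal (fun R => R ∈ C) Q₁ ∧ Maximal (fun R => R ∈ C) Q₂ ∧ Q₁ ≠ Q₂ ∧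
    H = affineSpan ℝ (Q₁ ∩ Q₂)

end Polytope

/-- The hypersimplex: the convex hull of the 0-1 vectors with coordinates indexed by `ι` that have
exactly `r` ones. -/
def hypersimplex (ι : Type*) (r : ℕ) : Set (ι → ℝ) :=
  convexHull ℝ {x | ∃ S : Set ι, S.encard = r ∧ x = S.indicator 1}

namespace Matroid

variable {α : Type*}

/-! ### Matroid notions -/

/-- A matroid is connected if any two distinct elements of its ground set lie in a common
circuit. -/
def IsConnected (M : Matroid α) : Prop :=
  ∀ e ∈ M.E, ∀ f ∈ M.E, e ≠ f → ∃ C, M.IsCircuit C ∧ e ∈ C ∧ f ∈ C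

/-- A matroid is uniform if, for some `r`, the independent sets are exactly the subsets of the
ground set with at most `r` elements. -/
def IsUniform (M : Matroid α) : Prop :=
  ∃ r : ℕ, ∀ I ⊆ M.E, M.Indep I ↔ I.encard ≤ r

/-- A set is cyclic if it is a (possibly empty) union of circuits. -/
def IsCyclic (M : Matroid α) (Z : Set α) : Prop :=
  ∃ 𝒞 : Set (Set α), (∀ C ∈ 𝒞, M.IsCircuit C) ∧ Z = ⋃₀ 𝒞

/-- A proper cyclic flat: a flat `Z` that is cyclic and satisfies `0 < r(Z) < r(M)`. -/
def IsProperCyclicFlat (M : Matroid α) (Z : Set α) : Prop :=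
  M.IsFlat Z ∧ 0 < M.eRk Z ∧ M.eRk Z < M.eRank ∧ M.IsCyclic Z

/-! ### The matroid polytope, flacets, and split matroids

For a matroid `M` with finite ground set, `M.E → ℝ` is the coordinate space indexed by the ground
set. -/

/-- The matroid polytope: the convex hull of the characteristic vectors of the bases. -/
def polytope (M : Matroid α) : Set (M.E → ℝ) :=
  convexHull ℝ {x | ∃ B, M.IsBase B ∧ x = Set.indicator {i : M.E | (i : α) ∈ B} 1}

/-- The set `H(F)` of all `x` with `∑ i ∈ F, x i = r(F)`. -/
def flatHyperplane (M : Matroid α) (F : Set α) : Set (M.E → ℝ) :=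
  {x | ∑ᶠ (i : M.E) (_ : (i : α) ∈ F), x i = ((M.eRk F).toNat : ℝ)}

/-- A flacet: a flat `F` such that `H(F)` meets the matroid polytope in a facet, and that is
inclusion-minimal among the flats that give this facet. -/
def IsFlacet (M : Matroid α) (F : Set α) : Prop :=
  M.IsFlat F ∧ IsFacetOf M.polytope (M.flatHyperplane F ∩ M.polytope) ∧
  ∀ G : Set α, M.IsFlat G → G ⊆ F →
    M.flatHyperplane G ∩ M.polytope = M.flatHyperplane F ∩ M.polytope → G = F

/-- A split flacet: a flacet `F` such that the intersection of `H(F)` with the hypersimplex spans a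
split hyperplane of the hypersimplex. -/
def IsSplitFlacet (M : Matroid α) (F : Set α) : Prop :=
  M.IsFlacet F ∧
  IsSplitHyperplane (hypersimplex M.E M.eRank.toNat)
    (affineSpan ℝ (M.flatHyperplane F ∩ hypersimplex M.E M.eRank.toNat))

/-- A split matroid: for distinct split flacets `F₁` and `F₂`, no point of `H(F₁) ∩ H(F₂)` is in the
relative interior of the intersection of the unit cube with the affine span of the matroid
polytope. -/
def IsSplitMatroid (M : Matroid α) : Prop :=
  ∀ F₁ F₂ : Set α, M.IsSplitFlacet F₁ → M.IsSplitFlacet F₂ → F₁ ≠ F₂ →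
    ∀ x ∈ M.flatHyperplane F₁ ∩ M.flatHyperplane F₂,
      x ∉ intrinsicInterior ℝ
        ((affineSpan ℝ M.polytope : Set (M.E → ℝ)) ∩ Set.Icc (0 : M.E → ℝ) 1)

end Matroid

/-! Connectivity is used in rank form: a minor is connected when submodularity is strict across
every nontrivial partition of its ground set. For connected `M` the polyhedral side becomes
combinatorial (`isSplitFlacet_iff`, `isSplitMatroid_iff`). The split flacets are the sets `F` with
`M|F` and `M/F` connected, `0 < r(F) < |F|`, `r(F) < r(M)` and `r(M) < r(F) + |E \ F|`; here `x(S)`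
denotes the coordinate sum over `S`. The affine span of `P(M)` is `x(E) = r(M)`, and its relative
interior in the cube is given by `0 < x i < 1`. So `M` is split iff no two distinct split sets have
hyperplanes that share such a point.

Uniformity prevents a common point (`not_meetInside_of_isUniform`). If the restrictions to `F`, `G`
and the dual restrictions to their complements are uniform, then `F ∩ G` is independent and `F ∪ G`
is spanning. Then `r(F ∩ G) + r(M) ≤ r(F) + r(G) = x(F ∩ G) + x(F ∪ G)`, which forces `F` and `G` to
be complementary, against connectivity of `M`.

Conversely, let `Z` be a connected proper cyclic flat of a split matroid. A separation of `M/Z`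
would produce two split sets that meet inside (`exists_meetInside_of_not_connBetween`), so `Z` is
itself a split set. If `M|Z` were not uniform, it would contain a circuit `C` with `r(C) < r(Z)`;
the closure of `C` is then a split set strictly inside `Z`, and nested split sets always meet inside
(`exists_meetInside_of_ssubset`). The dual statement follows because split sets and common interior
points dualize, by complementation and `x ↦ 1 - x`. -/

namespace Matroid

variable {α : Type*} {M : Matroid α} {A C D F G I X Y Z : Set α} {e f : α}

/-! ### Natural-number rank -/

/-- The rank of a set, as a natural number. -/
noncomputable def rk (M : Matroid α) (X : Set α) : ℕ := (M.eRk X).toNat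

lemma coe_rk (M : Matroid α) [M.RankFinite] (X : Set α) : (M.rk X : ℕ∞) = M.eRk X :=
  ENat.natCast_toNat (eRk_ne_top_iff.2 (M.isRkFinite_set X))

@[simp] lemma rk_empty (M : Matroid α) : M.rk ∅ = 0 := by simp [rk]

lemma rk_mono (M : Matroid α) [M.RankFinite] (h : X ⊆ Y) : M.rk X ≤ M.rk Y := by
  have := M.eRk_mono h
  rw [← coe_rk, ← coe_rk] at this
  exact_mod_cast this

lemma rk_inter_add_rk_union_le (M : Matroid α) [M.RankFinite] (X Y : Set α) :
    M.rk (X ∩ Y) + M.rk (X ∪ Y) ≤ M.rk X + M.rk Y := by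
  have := M.eRk_inter_add_eRk_union_le X Y
  simp only [← coe_rk] at this
  exact_mod_cast this

lemma rk_closure (M : Matroid α) (X : Set α) : M.rk (M.closure X) = M.rk X := by
  simp [rk]

lemma IsBasis.ncard_eq_rk (h : M.IsBasis I X) : I.ncard = M.rk X := by
  rw [rk, h.eRk_eq_encard, Set.ncard_def]

lemma IsBase.ncard_eq_rk {B : Set α} (h : M.IsBase B) : B.ncard = M.rk M.E :=
  h.isBasis_ground.ncard_eq_rk

lemma Indep.ncard_eq_rk (h : M.Indep I) : I.ncard = M.rk I :=
  h.isBasis_self.ncard_eq_rk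

lemma rk_le_ncard (M : Matroid α) [M.Finite] (hX : X ⊆ M.E := by aesop_mat) :
    M.rk X ≤ X.ncard := by
  obtain ⟨J, hJ⟩ := M.exists_isBasis X
  rw [← hJ.ncard_eq_rk]
  exact Set.ncard_le_ncard hJ.subset (M.ground_finite.subset hX)

lemma Indep.ncard_le_rk [M.Finite] (hI : M.Indep I) (hIX : I ⊆ X) : I.ncard ≤ M.rk X := by
  rw [hI.ncard_eq_rk]
  exact M.rk_mono hIX

lemma indep_of_ncard_le_rk [M.Finite] (hX : X ⊆ M.E) (h : X.ncard ≤ M.rk X) : M.Indep X := by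
  obtain ⟨J, hJ⟩ := M.exists_isBasis X
  rw [← hJ.ncard_eq_rk] at h
  rw [← Set.eq_of_subset_of_ncard_le hJ.subset h (M.ground_finite.subset hX)]
  exact hJ.indep

lemma IsCircuit.rk_add_one (hC : M.IsCircuit C) [M.Finite] : M.rk C + 1 = C.ncard := by
  have h := hC.eRk_add_one_eq
  rw [← coe_rk, ← (M.ground_finite.subset hC.subset_ground).cast_ncard_eq] at h
  exact_mod_cast h

lemma IsFlat.rk_lt_rk [M.RankFinite] (hF : M.IsFlat F) (hX : X ⊆ M.E) (h : F ⊂ X) :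
    M.rk F < M.rk X := by
  refine lt_of_le_of_ne (M.rk_mono h.subset) fun heq ↦ h.not_subset ?_
  have h1 := (M.isRkFinite_set F).closure_eq_closure_of_subset_of_eRk_ge_eRk h.subset
    (by rw [← coe_rk, ← coe_rk, heq])
  rw [← hF.closure, h1]
  exact M.subset_closure X

lemma rk_dual (M : Matroid α) [M.Finite] (hX : X ⊆ M.E) :
    M✶.rk X + M.rk M.E = M.rk (M.E \ X) + X.ncard := by
  have h := M.eRk_dual_add_eRank X
  rw [← eRk_ground, ← coe_rk, ← coe_rk, ← coe_rk,
    ← (M.ground_finite.subset hX).cast_ncard_eq] at h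
  exact_mod_cast h

/-- Two applications of submodularity. The use is monotonicity: the defect `r(X) + r(Z \ X) - r(Z)`
of a partition does not grow when the partition is restricted to `C ⊆ Z`. -/
lemma rk_add_rk_sdiff_add_rk_inter_le [M.RankFinite] (hX : X ⊆ Z) (hC : C ⊆ Z) :
    M.rk Z + M.rk (C \ X) + M.rk (C ∩ X) ≤ M.rk X + M.rk (Z \ X) + M.rk C := by
  have h1 := M.rk_inter_add_rk_union_le X C
  have h2 := M.rk_inter_add_rk_union_le (X ∪ C) (Z \ X)
  rw [show (X ∪ C) ∩ (Z \ X) = C \ X by grind, show (X ∪ C) ∪ (Z \ X) = Z by grind] at h2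
  rw [Set.inter_comm] at h1
  omega

/-! ### Connectivity in terms of rank -/

/-- The minor of `M` obtained by restricting to `D` and contracting `A` is connected. -/
def ConnBetween (M : Matroid α) (A D : Set α) : Prop :=
  ∀ X, A ⊂ X → X ⊂ D → M.rk A + M.rk D < M.rk X + M.rk (A ∪ (D \ X))

/-- Transitivity of lying in a common circuit, by induction on `|C₁ ∪ C₂|`. Eliminating a common
element `g` gives `C₃ ∋ e` and `C₄ ∋ f`, both avoiding `g`. Either `C₃`, `C₄` meet and their union
misses `g`, or `C₃`, `C₂` meet and their union misses an element of `C₁`. -/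
lemma exists_isCircuit_of_inter_nonempty [M.Finite] :
    ∀ (n : ℕ) {C₁ C₂ : Set α}, (C₁ ∪ C₂).ncard ≤ n → M.IsCircuit C₁ → M.IsCircuit C₂ →
      e ∈ C₁ → f ∈ C₂ → (C₁ ∩ C₂).Nonempty →
      ∃ C, M.IsCircuit C ∧ e ∈ C ∧ f ∈ C ∧ C ⊆ C₁ ∪ C₂ := by
  intro n
  induction n with
  | zero =>
    intro C₁ C₂ hn h1 h2 he
    rw [Nat.le_zero, Set.ncard_eq_zero (M.ground_finite.subset
      (Set.union_subset h1.subset_ground h2.subset_ground))] at hn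
    exact absurd (hn ▸ Set.mem_union_left C₂ he) (Set.notMem_empty e)
  | succ n ih =>
    intro C₁ C₂ hn h1 h2 he hf ⟨g, hg1, hg2⟩
    have hfin : (C₁ ∪ C₂).Finite := M.ground_finite.subset
      (Set.union_subset h1.subset_ground h2.subset_ground)
    have small : ∀ {S : Set α}, S ⊂ C₁ ∪ C₂ → S.ncard ≤ n := fun hS ↦ by
      have := Set.ncard_lt_ncard hS hfin
      omega
    by_cases hf1 : f ∈ C₁
    · exact ⟨C₁, h1, he, hf1, Set.subset_union_left⟩
    by_cases he2 : e ∈ C₂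
    · exact ⟨C₂, h2, he2, hf, Set.subset_union_right⟩
    obtain ⟨C₃, hC₃, h3, he3⟩ := h1.strong_elimination h2 hg1 hg2 he he2
    obtain ⟨C₄, hC₄, h4, hf4⟩ := h2.strong_elimination h1 hg2 hg1 hf hf1
    have m3 : ∃ a ∈ C₃, a ∈ C₂ ∧ a ∉ C₁ := by
      by_contra! hcon
      have : C₃ ⊆ C₁ := fun a ha ↦ by
        by_contra h
        rcases (hC₃ ha).1 with h' | h'
        · exact h h'
        · exact h (hcon a ha h')
      rw [← h3.eq_of_subset_isCircuit h1 this] at hg1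
      exact (hC₃ hg1).2 rfl
    have m4 : ∃ a ∈ C₄, a ∈ C₁ ∧ a ∉ C₂ := by
      by_contra! hcon
      have : C₄ ⊆ C₂ := fun a ha ↦ by
        by_contra h
        rcases (hC₄ ha).1 with h' | h'
        · exact h h'
        · exact h (hcon a ha h')
      rw [← h4.eq_of_subset_isCircuit h2 this] at hg2
      exact (hC₄ hg2).2 rfl
    have s3 : C₃ ⊆ C₁ ∪ C₂ := fun a ha ↦ (hC₃ ha).1
    have s4 : C₄ ⊆ C₁ ∪ C₂ := fun a ha ↦ (Set.union_comm C₂ C₁ ▸ (hC₄ ha).1)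
    obtain ⟨a, ha3, ha2, -⟩ := m3
    obtain ⟨b, hb4, hb1, hb2⟩ := m4
    by_cases hb3 : b ∈ C₃
    · have hss : C₃ ∪ C₄ ⊂ C₁ ∪ C₂ := by
        refine ⟨Set.union_subset s3 s4, fun h ↦ ?_⟩
        rcases h (Or.inl hg1) with h | h
        · exact (hC₃ h).2 rfl
        · exact (hC₄ h).2 rfl
      obtain ⟨C, hC, heC, hfC, hsub⟩ := ih (small hss) h3 h4 he3 hf4 ⟨b, hb3, hb4⟩
      exact ⟨C, hC, heC, hfC, hsub.trans hss.subset⟩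
    · have hss : C₃ ∪ C₂ ⊂ C₁ ∪ C₂ := by
        refine ⟨Set.union_subset s3 Set.subset_union_right, fun h ↦ ?_⟩
        rcases h (Or.inl hb1) with h | h
        · exact hb3 h
        · exact hb2 h
      obtain ⟨C, hC, heC, hfC, hsub⟩ := ih (small hss) h3 h2 he3 hf ⟨a, ha3, ha2⟩
      exact ⟨C, hC, heC, hfC, hsub.trans hss.subset⟩

/-- A circuit crossing `X` has proper independent traces on both sides, so its defect is one.
Conversely, the class `K` of `e` contains every circuit that meets it, so bases of `K` and `Z \ K`
have independent union and the defect of `K` is zero. -/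
lemma isConnected_restrict_iff [M.Finite] (hZ : Z ⊆ M.E) :
    (M.restrict Z).IsConnected ↔ M.ConnBetween ∅ Z := by
  constructor
  · intro h X hX hXZ
    obtain ⟨e, he⟩ := Set.ssubset_iff_exists.1 hX |>.2
    obtain ⟨f, hfZ, hfX⟩ := Set.exists_of_ssubset hXZ
    obtain ⟨C, hC, heC, hfC⟩ := h e (hXZ.subset he.1) f hfZ (by grind)
    rw [restrict_isCircuit_iff hZ] at hC
    obtain ⟨hC, hCZ⟩ := hC
    have h1 := M.rk_add_rk_sdiff_add_rk_inter_le hXZ.subset hCZ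
    have h2 := (hC.ssubset_indep (X := C \ X) (by grind)).ncard_eq_rk
    have h3 := (hC.ssubset_indep (X := C ∩ X) (by grind)).ncard_eq_rk
    have h4 := hC.rk_add_one
    have h5 := Set.ncard_inter_add_ncard_sdiff_eq_ncard C X
      (M.ground_finite.subset hC.subset_ground)
    simp only [rk_empty, Set.empty_union]
    omega
  · intro h e he f hf hef
    change e ∈ Z at he
    change f ∈ Z at hf
    simp only [restrict_isCircuit_iff hZ]
    set K := {g | g ∈ Z ∧ (g = e ∨ ∃ C, (M.IsCircuit C ∧ C ⊆ Z) ∧ e ∈ C ∧ g ∈ C)} with hK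
    have hKZ : K ⊆ Z := fun g hg ↦ hg.1
    have heK : e ∈ K := ⟨he, Or.inl rfl⟩
    have hcirc : ∀ C, M.IsCircuit C → C ⊆ Z → (C ∩ K).Nonempty → C ⊆ K := by
      rintro C hC hCZ ⟨k, hkC, hkZ, rfl | ⟨C', ⟨hC', hC'Z⟩, he', hk'⟩⟩ a ha
      · exact ⟨hCZ ha, Or.inr ⟨C, ⟨hC, hCZ⟩, hkC, ha⟩⟩
      · obtain ⟨C₃, h3, h3e, h3a, h3s⟩ :=
          exists_isCircuit_of_inter_nonempty _ le_rfl hC' hC he' ha ⟨k, hk', hkC⟩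
        exact ⟨hCZ ha, Or.inr ⟨C₃, ⟨h3, h3s.trans (Set.union_subset hC'Z hCZ)⟩, h3e, h3a⟩⟩
    by_cases hfK : f ∈ K
    · obtain ⟨-, rfl | ⟨C, hC, h1, h2⟩⟩ := hfK
      · exact absurd rfl hef
      · exact ⟨C, hC, h1, h2⟩
    exfalso
    have h1 := h K (Set.ssubset_iff_exists.2 ⟨Set.empty_subset _, e, heK, by simp⟩)
      (Set.ssubset_iff_exists.2 ⟨hKZ, f, hf, hfK⟩)
    obtain ⟨I, hI⟩ := M.exists_isBasis K (hKZ.trans hZ)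
    obtain ⟨J, hJ⟩ := M.exists_isBasis (Z \ K) (Set.sdiff_subset.trans hZ)
    have hIJZ : I ∪ J ⊆ Z :=
      Set.union_subset (hI.subset.trans hKZ) (hJ.subset.trans Set.sdiff_subset)
    have hind : M.Indep (I ∪ J) := by
      rw [indep_iff_forall_subset_not_isCircuit (hIJZ.trans hZ)]
      intro C hCs hC
      by_cases hne : (C ∩ K).Nonempty
      · have hCK := hcirc C hC (hCs.trans hIJZ) hne
        exact hC.not_indep (hI.indep.subset fun a ha ↦
          (hCs ha).resolve_right fun haJ ↦ (hJ.subset haJ).2 (hCK ha))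
      · exact hC.not_indep (hJ.indep.subset fun a ha ↦
          (hCs ha).resolve_left fun haI ↦ hne ⟨a, ha, hI.subset haI⟩)
    have h2 := hind.ncard_le_rk hIJZ
    rw [Set.ncard_union_eq (Set.disjoint_left.2 fun a ha ha' ↦ (hJ.subset ha').2 (hI.subset ha))
      (M.ground_finite.subset hI.left_subset_ground)
      (M.ground_finite.subset hJ.left_subset_ground), hI.ncard_eq_rk, hJ.ncard_eq_rk] at h2
    simp only [rk_empty, Set.empty_union] at h1
    omega

lemma isConnected_iff [M.Finite] : M.IsConnected ↔ M.ConnBetween ∅ M.E := by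
  rw [← isConnected_restrict_iff subset_rfl]
  rw [restrict_ground_eq_self]

lemma ConnBetween.rk_pos [M.RankFinite] (h : M.ConnBetween ∅ D) (hD : 0 < M.rk D)
    (hX : X ⊆ D) (hne : X.Nonempty) : 0 < M.rk X := by
  obtain rfl | hss := hX.eq_or_ssubset
  · exact hD
  have h1 := h X (Set.empty_ssubset.2 hne) hss
  have h2 := M.rk_mono (X := ∅ ∪ (D \ X)) (Y := D) (by grind)
  omega

lemma ConnBetween.rk_lt_add (h : M.ConnBetween ∅ D) (hX : X ⊂ D) (hne : X.Nonempty) :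
    M.rk D < M.rk X + M.rk (D \ X) := by
  have h1 := h X (Set.empty_ssubset.2 hne) hX
  simpa using h1

lemma connBetween_empty_iff :
    M.ConnBetween ∅ D ↔ ∀ X ⊂ D, X.Nonempty → M.rk D < M.rk X + M.rk (D \ X) := by
  refine ⟨fun h X hX hne ↦ h.rk_lt_add hX hne, fun h X h0 hX ↦ ?_⟩
  simpa using h X hX (Set.nonempty_iff_ne_empty.2 fun h' ↦ h0.ne h'.symm)

/-- Duality exchanges restriction and contraction; in the dual rank formula the cardinalities on the
two sides cancel. -/
lemma ConnBetween.dual [M.Finite] (hAD : A ⊆ D) (hD : D ⊆ M.E) (h : M.ConnBetween A D) :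
    M✶.ConnBetween (M.E \ D) (M.E \ A) := by
  intro X h1 h2
  have hXE : X ⊆ M.E := h2.subset.trans Set.sdiff_subset
  have hk := h (M.E \ X) (by grind) (by grind)
  have e1 := M.rk_dual (X := M.E \ D) Set.sdiff_subset
  have e2 := M.rk_dual (X := M.E \ A) Set.sdiff_subset
  have e3 := M.rk_dual hXE
  have e4 := M.rk_dual (X := (M.E \ D) ∪ ((M.E \ A) \ X)) (by grind)
  rw [show M.E \ (M.E \ D) = D by grind] at e1
  rw [show M.E \ (M.E \ A) = A by grind] at e2
  rw [show M.E \ ((M.E \ D) ∪ ((M.E \ A) \ X)) = A ∪ (D \ (M.E \ X)) by grind] at e4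
  have hf : ∀ S ⊆ M.E, S.Finite := fun S hS ↦ M.ground_finite.subset hS
  have c1 := Set.ncard_union_add_ncard_inter X ((M.E \ D) ∪ ((M.E \ A) \ X))
    (hf _ hXE) (hf _ (by grind))
  rw [show X ∪ ((M.E \ D) ∪ ((M.E \ A) \ X)) = M.E \ A by grind,
    show X ∩ ((M.E \ D) ∪ ((M.E \ A) \ X)) = M.E \ D by grind] at c1
  omega

end Matroid

/-! ### Sums of coordinates -/

section CoordSum

variable {ι : Type*} [Finite ι] {S T : Set ι} {x y : ι → ℝ}

/-- The linear functional summing the coordinates in `S`. -/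
noncomputable def coordSum (S : Set ι) : (ι → ℝ) →L[ℝ] ℝ :=
  LinearMap.toContinuousLinearMap
    { toFun := fun x ↦ ∑ᶠ i ∈ S, x i
      map_add' := fun _ _ ↦ finsum_mem_add_distrib S.toFinite
      map_smul' := fun c x ↦ by
        simp only [finsum_mem_eq_finite_toFinset_sum _ S.toFinite, Pi.smul_apply,
          Finset.smul_sum, RingHom.id_apply] }

lemma coordSum_apply (S : Set ι) (x : ι → ℝ) : coordSum S x = ∑ᶠ i ∈ S, x i := rfl

@[simp] lemma coordSum_empty (x : ι → ℝ) : coordSum ∅ x = 0 := by simp [coordSum_apply]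

lemma coordSum_union (h : Disjoint S T) (x : ι → ℝ) :
    coordSum (S ∪ T) x = coordSum S x + coordSum T x :=
  finsum_mem_union h S.toFinite T.toFinite

lemma coordSum_union_add_inter (S T : Set ι) (x : ι → ℝ) :
    coordSum (S ∪ T) x + coordSum (S ∩ T) x = coordSum S x + coordSum T x :=
  finsum_mem_union_inter S.toFinite T.toFinite

lemma coordSum_add_sdiff (h : S ⊆ T) (x : ι → ℝ) :
    coordSum S x + coordSum (T \ S) x = coordSum T x :=
  finsum_mem_add_sdiff h T.toFinite

lemma coordSum_congr (h : ∀ i ∈ S, x i = y i) : coordSum S x = coordSum S y :=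
  finsum_mem_congr rfl h

lemma coordSum_const (S : Set ι) (c : ℝ) : coordSum S (fun _ ↦ c) = S.ncard * c := by
  rw [coordSum_apply, finsum_mem_eq_finite_toFinset_sum _ S.toFinite]
  simp [Set.ncard_eq_toFinset_card S]

lemma coordSum_mono (h : ∀ i ∈ S, x i ≤ y i) : coordSum S x ≤ coordSum S y := by
  rw [coordSum_apply, coordSum_apply, finsum_mem_eq_finite_toFinset_sum _ S.toFinite,
    finsum_mem_eq_finite_toFinset_sum _ S.toFinite]
  exact Finset.sum_le_sum fun i hi ↦ h i (by simpa using hi)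

lemma coordSum_lt_coordSum (hS : S.Nonempty) (h : ∀ i ∈ S, x i < y i) :
    coordSum S x < coordSum S y := by
  rw [coordSum_apply, coordSum_apply, finsum_mem_eq_finite_toFinset_sum _ S.toFinite,
    finsum_mem_eq_finite_toFinset_sum _ S.toFinite]
  exact Finset.sum_lt_sum_of_nonempty (by simpa using hS) fun i hi ↦ h i (by simpa using hi)

lemma coordSum_nonneg (h : ∀ i ∈ S, 0 ≤ x i) : 0 ≤ coordSum S x := by
  have := coordSum_mono (x := fun _ ↦ 0) h
  rwa [coordSum_const, mul_zero] at this

lemma coordSum_le_ncard (h : ∀ i ∈ S, x i ≤ 1) : coordSum S x ≤ S.ncard := by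
  have := coordSum_mono (y := fun _ ↦ 1) h
  rwa [coordSum_const, mul_one] at this

lemma coordSum_lt_ncard (hS : S.Nonempty) (h : ∀ i ∈ S, x i < 1) : coordSum S x < S.ncard := by
  have := coordSum_lt_coordSum (y := fun _ ↦ 1) hS h
  rwa [coordSum_const, mul_one] at this

lemma coordSum_pos (hS : S.Nonempty) (h : ∀ i ∈ S, 0 < x i) : 0 < coordSum S x := by
  have := coordSum_lt_coordSum (x := fun _ ↦ 0) hS h
  rwa [coordSum_const, mul_zero] at this

lemma coordSum_indicator (S T : Set ι) : coordSum S (T.indicator 1) = (S ∩ T).ncard := by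
  classical
  rw [← Set.inter_union_sdiff S T, coordSum_union Set.disjoint_sdiff_inter.symm,
    coordSum_congr (y := fun _ ↦ 1) fun i hi ↦ by simp [hi.2], coordSum_const,
    coordSum_congr (S := S \ T) (y := fun _ ↦ 0) fun i hi ↦ by simp [hi.2], coordSum_const]
  rw [Set.inter_union_sdiff S T]
  simp

end CoordSum

namespace Matroid

variable {α : Type*} {M : Matroid α} {A B C D F G I X Y Z : Set α} {e f : α}

instance finite_ground_elem [M.Finite] : Finite M.E := M.ground_finite.to_subtype

/-- The sum of the coordinates in `F`, for vectors indexed by the ground set of `M`. -/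
noncomputable def groundSum (M : Matroid α) [M.Finite] (F : Set α) : (M.E → ℝ) →L[ℝ] ℝ :=
  coordSum (Subtype.val ⁻¹' F)

lemma mem_flatHyperplane_iff [M.Finite] {x : M.E → ℝ} :
    x ∈ M.flatHyperplane F ↔ M.groundSum F x = M.rk F := Iff.rfl

lemma ncard_preimage_ground (hF : F ⊆ M.E) : (Subtype.val ⁻¹' F : Set M.E).ncard = F.ncard :=
  Set.ncard_preimage_of_injective_subset_range Subtype.val_injective (by simpa using hF)

lemma groundSum_add_sdiff [M.Finite] (h : F ⊆ G) (x : M.E → ℝ) :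
    M.groundSum F x + M.groundSum (G \ F) x = M.groundSum G x :=
  coordSum_add_sdiff (Set.preimage_mono h) x

lemma groundSum_union_add_inter [M.Finite] (F G : Set α) (x : M.E → ℝ) :
    M.groundSum (F ∪ G) x + M.groundSum (F ∩ G) x = M.groundSum F x + M.groundSum G x :=
  coordSum_union_add_inter _ _ x

/-! ### The combinatorial form of split flacets -/

/-- The combinatorial description of the split flacets of a connected matroid. -/
structure IsSplitSet (M : Matroid α) (F : Set α) : Prop where
  subset_ground : F ⊆ M.E
  conn_restrict : M.ConnBetween ∅ F
  conn_contract : M.ConnBetween F M.E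
  rk_pos : 0 < M.rk F
  rk_lt_ncard : M.rk F < F.ncard
  rk_lt_rk : M.rk F < M.rk M.E
  rk_ground_lt : M.rk M.E < M.rk F + (M.E \ F).ncard

/-- The hyperplanes of `F` and `G` meet in the relative interior of the hypersimplex. -/
def MeetInside (M : Matroid α) [M.Finite] (F G : Set α) : Prop :=
  ∃ x : M.E → ℝ, (∀ i, 0 < x i ∧ x i < 1) ∧ M.groundSum M.E x = M.rk M.E ∧
    M.groundSum F x = M.rk F ∧ M.groundSum G x = M.rk G

/-- Elements of the closure outside `F` are loops of `M/F`, which is connected of positive rank. -/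
lemma IsSplitSet.isFlat [M.Finite] (h : M.IsSplitSet F) : M.IsFlat F := by
  rw [isFlat_iff_closure_eq]
  by_contra hne
  have hss : F ⊂ M.closure F := (M.subset_closure F h.subset_ground).ssubset_of_ne (Ne.symm hne)
  have hk := M.rk_closure F
  have hcE : M.closure F ⊂ M.E := (M.closure_subset_ground F).ssubset_of_ne fun heq ↦ by
    have := h.rk_lt_rk
    rw [heq] at hk
    omega
  have h1 := h.conn_contract _ hss hcE
  have h2 := M.rk_mono (X := F ∪ (M.E \ M.closure F)) (Y := M.E)
    (Set.union_subset h.subset_ground Set.sdiff_subset)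
  omega

/-- The conditions swap in pairs: restriction with contraction, `rk_pos` with `rk_ground_lt`, and
`rk_lt_ncard` with `rk_lt_rk`. -/
lemma IsSplitSet.dual [M.Finite] (h : M.IsSplitSet F) : M✶.IsSplitSet (M.E \ F) := by
  have hF := h.subset_ground
  have e1 := M.rk_dual (X := M.E \ F) Set.sdiff_subset
  have e2 := M.rk_dual (X := M.E) subset_rfl
  have h0 := M.rk_empty
  rw [Set.sdiff_sdiff_cancel_left hF] at e1
  rw [Set.sdiff_self] at e2
  have c := Set.ncard_sdiff_add_ncard_of_subset hF M.ground_finite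
  have := h.rk_pos
  have := h.rk_lt_ncard
  have := h.rk_lt_rk
  have := h.rk_ground_lt
  refine ⟨Set.sdiff_subset, ?_, ?_, ?_, ?_, ?_, ?_⟩
  · simpa using h.conn_contract.dual hF subset_rfl
  · simpa using h.conn_restrict.dual (Set.empty_subset _) hF
  · omega
  · omega
  · rw [dual_ground]; omega
  · rw [dual_ground, Set.sdiff_sdiff_cancel_left hF]; omega

lemma groundSum_one_sub [M.Finite] (hF : F ⊆ M.E) (x : M.E → ℝ) :
    M.groundSum F (fun i ↦ 1 - x i) = F.ncard - M.groundSum F x := by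
  have h1 : M.groundSum F (fun _ ↦ 1) = F.ncard := by
    rw [groundSum, coordSum_const, ncard_preimage_ground hF, mul_one]
  rw [← h1, ← map_sub]
  rfl

lemma MeetInside.dual [M.Finite] (hF : F ⊆ M.E) (hG : G ⊆ M.E) (h : M.MeetInside F G) :
    M✶.MeetInside (M.E \ F) (M.E \ G) := by
  obtain ⟨x, hx, hE, h1, h2⟩ := h
  have key : ∀ S ⊆ M.E, M.groundSum S x = M.rk S →
      M.groundSum (M.E \ S) (fun i ↦ 1 - x i) = M✶.rk (M.E \ S) := by
    intro S hS hxS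
    have e1 := M.rk_dual (X := M.E \ S) Set.sdiff_subset
    rw [Set.sdiff_sdiff_cancel_left hS] at e1
    have e2 := groundSum_add_sdiff hS x
    have e3 := groundSum_one_sub (Set.sdiff_subset (s := M.E) (t := S)) x
    have e1' : (M✶.rk (M.E \ S) : ℝ) + M.rk M.E = M.rk S + (M.E \ S).ncard := by exact_mod_cast e1
    linarith
  refine ⟨fun i ↦ 1 - x i, fun i ↦ ?_, ?_, key F hF h1, key G hG h2⟩
  · have := hx i
    constructor <;> linarith
  · have := key ∅ (Set.empty_subset _) (by simp [groundSum])
    rw [Set.sdiff_empty] at this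
    exact this

/-! ### Uniform restrictions prevent hyperplanes from meeting inside -/

/-- A dependent set in a uniform matroid of rank `k` has more than `k` elements, hence contains an
independent `k`-set and has full rank. -/
lemma indep_of_isUniform_restrict [M.Finite] (hF : F ⊆ M.E) (h : (M.restrict F).IsUniform)
    (hX : X ⊆ F) (hr : M.rk X < M.rk F) : M.Indep X := by
  obtain ⟨k, hk⟩ := h
  have hk' : ∀ I ⊆ F, M.Indep I ↔ I.encard ≤ k := fun I hI ↦ by
    rw [← hk I hI, restrict_indep_iff]
    simp [hI]
  by_contra hdep
  rw [hk' X hX, not_le] at hdep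
  obtain ⟨J, hJX, hJ⟩ := Set.exists_subset_encard_eq hdep.le
  have hJi : M.Indep J := (hk' J (hJX.trans hX)).2 hJ.le
  have h1 := hJi.ncard_le_rk hJX
  obtain ⟨B, hB⟩ := M.exists_isBasis F hF
  have h2 := (hk' B hB.subset).1 hB.indep
  rw [← (M.ground_finite.subset hB.left_subset_ground).cast_ncard_eq, hB.ncard_eq_rk] at h2
  rw [← (M.ground_finite.subset hJi.subset_ground).cast_ncard_eq] at hJ
  have h2' : M.rk F ≤ k := by exact_mod_cast h2
  have hJ' : J.ncard = k := by exact_mod_cast hJ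
  omega

/-- The intersection is a flat properly contained in `F` or in `G`, so its rank drops there and
uniformity makes it independent. -/
lemma IsSplitSet.inter_indep [M.Finite] (hF : M.IsSplitSet F) (hG : M.IsSplitSet G) (hne : F ≠ G)
    (uF : (M.restrict F).IsUniform) (uG : (M.restrict G).IsUniform) : M.Indep (F ∩ G) := by
  have hflat : M.IsFlat (F ∩ G) := by
    rw [Set.inter_eq_iInter]
    exact IsFlat.iInter fun b ↦ by cases b; exacts [hG.isFlat, hF.isFlat]
  by_cases h : F ⊆ G
  · exact indep_of_isUniform_restrict hG.subset_ground uG Set.inter_subset_right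
      (hflat.rk_lt_rk hG.subset_ground (by
        rw [Set.inter_eq_left.2 h]; exact h.ssubset_of_ne hne))
  · exact indep_of_isUniform_restrict hF.subset_ground uF Set.inter_subset_left
      (hflat.rk_lt_rk hF.subset_ground (Set.inter_subset_left.ssubset_of_ne
        fun h' ↦ h (Set.inter_eq_left.1 h')))

lemma not_meetInside_of_isUniform [M.Finite] (hM : M.ConnBetween ∅ M.E)
    (hF : M.IsSplitSet F) (hG : M.IsSplitSet G) (hne : F ≠ G)
    (uF : (M.restrict F).IsUniform) (uG : (M.restrict G).IsUniform)
    (uF' : (M✶.restrict (M.E \ F)).IsUniform) (uG' : (M✶.restrict (M.E \ G)).IsUniform) :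
    ¬ M.MeetInside F G := by
  rintro ⟨x, hx, hE, hxF, hxG⟩
  have hFE := hF.subset_ground
  have hGE := hG.subset_ground
  have hU : F ∪ G ⊆ M.E := Set.union_subset hFE hGE
  have hI : F ∩ G ⊆ M.E := Set.inter_subset_left.trans hFE
  have h1 := (hF.inter_indep hG hne uF uG).ncard_eq_rk
  have h2 := (hF.dual.inter_indep hG.dual (fun h ↦ hne (by
    rw [← Set.sdiff_sdiff_cancel_left hFE, h, Set.sdiff_sdiff_cancel_left hGE])) uF' uG').ncard_eq_rk
  rw [show M.E \ F ∩ (M.E \ G) = M.E \ (F ∪ G) by grind] at h2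
  have h3 := M.rk_dual (X := M.E \ (F ∪ G)) Set.sdiff_subset
  rw [Set.sdiff_sdiff_cancel_left hU] at h3
  have h4 := M.rk_inter_add_rk_union_le F G
  have s1 := groundSum_union_add_inter F G x
  have s2 := groundSum_add_sdiff hU x
  -- `M.E \ (F ∪ G)` is independent in the dual, so `F ∪ G` has full rank.
  have h5 : (M.rk (F ∩ G) : ℝ) + M.rk M.E ≤ M.rk F + M.rk G := by
    have : M.rk (F ∩ G) + M.rk M.E ≤ M.rk F + M.rk G := by omega
    exact_mod_cast this
  have b1 : M.groundSum (F ∩ G) x ≤ (M.rk (F ∩ G) : ℝ) := by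
    rw [← h1, ← ncard_preimage_ground hI]
    exact coordSum_le_ncard fun i _ ↦ (hx i).2.le
  have b2 : 0 ≤ M.groundSum (M.E \ (F ∪ G)) x := coordSum_nonneg fun i _ ↦ (hx i).1.le
  -- Equality must hold in `b1` and `b2`, but each is strict on a nonempty set because the
  -- coordinates lie strictly between 0 and 1.
  have e1 : F ∩ G = ∅ := by
    by_contra hcon
    obtain ⟨a, ha⟩ := Set.nonempty_iff_ne_empty.2 hcon
    have : M.groundSum (F ∩ G) x < (M.rk (F ∩ G) : ℝ) := by
      rw [← h1, ← ncard_preimage_ground hI]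
      exact coordSum_lt_ncard ⟨⟨a, hI ha⟩, ha⟩ fun i _ ↦ (hx i).2
    linarith
  have e2 : M.E \ (F ∪ G) = ∅ := by
    by_contra hcon
    obtain ⟨a, ha⟩ := Set.nonempty_iff_ne_empty.2 hcon
    have : 0 < M.groundSum (M.E \ (F ∪ G)) x := coordSum_pos ⟨⟨a, ha.1⟩, ha⟩ fun i _ ↦ (hx i).1
    linarith
  have e3 : G = M.E \ F := by grind
  have hFss : F ⊂ M.E := hFE.ssubset_of_ne fun h ↦ by
    have := hF.rk_lt_rk
    rw [← h] at this
    omega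
  have hFne : F.Nonempty := by
    rw [Set.nonempty_iff_ne_empty]
    rintro rfl
    simpa using hF.rk_pos
  have h6 := hM.rk_lt_add hFss hFne
  rw [← e3] at h6
  rw [e1] at s1
  rw [e2] at s2
  simp only [groundSum, Set.preimage_empty, coordSum_empty] at s1 s2 hE hxF hxG
  have : (M.rk M.E : ℝ) = M.rk F + M.rk G := by linarith
  have : M.rk M.E = M.rk F + M.rk G := by exact_mod_cast this
  omega

/-! ### Separations give split sets whose hyperplanes meet inside -/

/-- Spread the prescribed sum evenly over each of the three blocks. -/
lemma exists_groundSum_eq [M.Finite] (hAB : Disjoint A B) (hAC : Disjoint A C)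
    (hBC : Disjoint B C) (hE : A ∪ B ∪ C = M.E) {a b c : ℝ} (ha : 0 < a) (ha' : a < A.ncard)
    (hb : 0 < b) (hb' : b < B.ncard) (hc : 0 < c) (hc' : c < C.ncard) :
    ∃ x : M.E → ℝ, (∀ i, 0 < x i ∧ x i < 1) ∧
      M.groundSum A x = a ∧ M.groundSum B x = b ∧ M.groundSum C x = c := by
  classical
  have hA : A ⊆ M.E := by rw [← hE]; exact Set.subset_union_left.trans Set.subset_union_left
  have hB : B ⊆ M.E := by rw [← hE]; exact Set.subset_union_right.trans Set.subset_union_left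
  have hC : C ⊆ M.E := by rw [← hE]; exact Set.subset_union_right
  have hA0 : (0 : ℝ) < A.ncard := ha.trans ha'
  have hB0 : (0 : ℝ) < B.ncard := hb.trans hb'
  have hC0 : (0 : ℝ) < C.ncard := hc.trans hc'
  refine ⟨fun i ↦ if (i : α) ∈ A then a / A.ncard else if (i : α) ∈ B then b / B.ncard
    else c / C.ncard, fun i ↦ ?_, ?_, ?_, ?_⟩
  · dsimp only
    split_ifs
    · exact ⟨by positivity, (div_lt_one hA0).2 ha'⟩
    · exact ⟨by positivity, (div_lt_one hB0).2 hb'⟩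
    · exact ⟨by positivity, (div_lt_one hC0).2 hc'⟩
  · rw [groundSum, coordSum_congr (y := fun _ ↦ a / A.ncard) (fun i hi ↦ ?_), coordSum_const,
      ncard_preimage_ground hA, mul_div_cancel₀ _ hA0.ne']
    exact if_pos hi
  · rw [groundSum, coordSum_congr (y := fun _ ↦ b / B.ncard) (fun i hi ↦ ?_), coordSum_const,
      ncard_preimage_ground hB, mul_div_cancel₀ _ hB0.ne']
    rw [if_neg fun h ↦ hAB.notMem_of_mem_left h hi]
    exact if_pos hi
  · rw [groundSum, coordSum_congr (y := fun _ ↦ c / C.ncard) (fun i hi ↦ ?_), coordSum_const,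
      ncard_preimage_ground hC, mul_div_cancel₀ _ hC0.ne']
    rw [if_neg fun h ↦ hAC.notMem_of_mem_left h hi, if_neg fun h ↦ hBC.notMem_of_mem_left h hi]

/-- The last condition is automatic: `r(M) < r(F) + r(E \ F) ≤ r(F) + |E \ F|` by connectivity of
`M`. -/
lemma IsSplitSet.of_connBetween [M.Finite] (hM : M.ConnBetween ∅ M.E) (hF : F ⊆ M.E)
    (h1 : M.ConnBetween ∅ F) (h2 : M.ConnBetween F M.E) (h3 : 0 < M.rk F)
    (h4 : M.rk F < F.ncard) (h5 : M.rk F < M.rk M.E) : M.IsSplitSet F := by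
  refine ⟨hF, h1, h2, h3, h4, h5, ?_⟩
  have hFss : F ⊂ M.E := hF.ssubset_of_ne fun h ↦ by rw [h] at h5; omega
  have hFne : F.Nonempty := by
    rw [Set.nonempty_iff_ne_empty]
    rintro rfl
    simp at h3
  have := hM.rk_lt_add hFss hFne
  have := M.rk_le_ncard (X := M.E \ F) Set.sdiff_subset
  omega

/-- A nontrivial separation of the contraction of `M` by `Z`. -/
structure IsSeparator (M : Matroid α) (Z Y : Set α) : Prop where
  ssubset_left : Z ⊂ Y
  ssubset_right : Y ⊂ M.E
  rk_add_le : M.rk Y + M.rk (Z ∪ (M.E \ Y)) ≤ M.rk M.E + M.rk Z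

lemma IsSeparator.symm (h : M.IsSeparator Z Y) : M.IsSeparator Z (Z ∪ (M.E \ Y)) := by
  obtain ⟨h1, h2, h3⟩ := h
  refine ⟨by grind, by grind, ?_⟩
  rw [show Z ∪ (M.E \ (Z ∪ (M.E \ Y))) = Y by grind]
  omega

/-- A separation of `M|Y` whose two parts both meet `Z` restricts to one of `M|Z`. Otherwise one
part `B` misses `Z`, and since `Y` separates `M/Z`, the set `B` would separate `M` itself (`aux`).
-/
lemma IsSeparator.connBetween [M.Finite] (hM : M.ConnBetween ∅ M.E) (hZ : M.ConnBetween ∅ Z)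
    (h : M.IsSeparator Z Y) : M.ConnBetween ∅ Y := by
  have hZY := h.ssubset_left.subset
  have hYE := h.ssubset_right.subset
  have hsep := h.rk_add_le
  have aux : ∀ B ⊆ Y, B.Nonempty → Disjoint B Z → M.rk Y < M.rk B + M.rk (Y \ B) := by
    intro B hB hBne hdisj
    have h1 := M.rk_inter_add_rk_union_le (Y \ B) (Z ∪ (M.E \ Y))
    rw [show (Y \ B) ∩ (Z ∪ (M.E \ Y)) = Z by grind,
      show (Y \ B) ∪ (Z ∪ (M.E \ Y)) = M.E \ B by grind] at h1
    have h2 := hM.rk_lt_add (X := B) (by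
      refine (hB.trans hYE).ssubset_of_ne ?_
      rintro rfl
      exact h.ssubset_right.not_subset hB) hBne
    omega
  rw [connBetween_empty_iff]
  intro X hX hXne
  by_contra! hcon
  have h1 := M.rk_add_rk_sdiff_add_rk_inter_le hX.subset hZY
  by_cases hd : Disjoint X Z
  · exact (aux X hX.subset hXne hd).not_ge hcon
  by_cases hd' : Disjoint (Y \ X) Z
  · have := aux (Y \ X) Set.sdiff_subset (Set.sdiff_nonempty.2 hX.not_subset) hd'
    rw [Set.sdiff_sdiff_cancel_left hX.subset] at this
    omega
  rw [Set.not_disjoint_iff] at hd hd'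
  obtain ⟨a, ha, haZ⟩ := hd
  obtain ⟨b, hb, hbZ⟩ := hd'
  have h2 := hZ.rk_lt_add (X := Z ∩ X)
    (Set.ssubset_iff_exists.2 ⟨Set.inter_subset_left, b, hbZ, fun h ↦ hb.2 h.2⟩) ⟨a, haZ, ha⟩
  rw [Set.sdiff_self_inter] at h2
  omega

/-- Take a maximal separator `F`: uncrossing shows that a separator of `M/F` is a larger separator
of `M/Z`. -/
lemma IsSeparator.exists_connBetween [M.Finite] (h : M.IsSeparator Z Y) :
    ∃ F, Y ⊆ F ∧ M.IsSeparator Z F ∧ M.ConnBetween F M.E := by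
  have hfin : {S | M.IsSeparator Z S}.Finite :=
    M.ground_finite.finite_subsets.subset fun S hS ↦ hS.ssubset_right.subset
  obtain ⟨F, hYF, hF⟩ := hfin.exists_le_maximal h
  have hsF : M.IsSeparator Z F := hF.prop
  refine ⟨F, hYF, hsF, fun U hFU hUE ↦ ?_⟩
  by_contra! hcon
  obtain ⟨hZF, hFE, hsep⟩ := hsF
  have h1 := M.rk_inter_add_rk_union_le (F ∪ (M.E \ U)) (Z ∪ (M.E \ F))
  rw [show (F ∪ (M.E \ U)) ∩ (Z ∪ (M.E \ F)) = Z ∪ (M.E \ U) by grind,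
    show (F ∪ (M.E \ U)) ∪ (Z ∪ (M.E \ F)) = M.E by grind] at h1
  have hU : M.IsSeparator Z U := ⟨hZF.trans hFU, hUE, by omega⟩
  exact hFU.not_subset (hF.le_of_ge hU hFU.subset)

lemma rk_lt_ncard_mono [M.Finite] (hY : Y ⊆ M.E) (hZY : Z ⊆ Y) (h : M.rk Z < Z.ncard) :
    M.rk Y < Y.ncard := by
  by_contra! hcon
  have := ((indep_of_ncard_le_rk hY hcon).subset hZY).ncard_eq_rk
  omega

lemma IsSeparator.exists_isSplitSet [M.Finite] (hM : M.ConnBetween ∅ M.E)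
    (hZ : M.ConnBetween ∅ Z) (hflat : M.IsFlat Z) (h0 : 0 < M.rk Z) (h1 : M.rk Z < Z.ncard)
    (h : M.IsSeparator Z Y) : ∃ F, Y ⊆ F ∧ M.IsSeparator Z F ∧ M.IsSplitSet F := by
  obtain ⟨F, hYF, hF, hc⟩ := h.exists_connBetween
  have hFE := hF.ssubset_right.subset
  refine ⟨F, hYF, hF, .of_connBetween hM hFE (hF.connBetween hM hZ) hc ?_ ?_ ?_⟩
  · exact h0.trans_le (M.rk_mono hF.ssubset_left.subset)
  · exact rk_lt_ncard_mono hFE hF.ssubset_left.subset h1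
  · have h2 := hflat.rk_lt_rk hF.symm.ssubset_right.subset hF.symm.ssubset_left
    have := hF.rk_add_le
    omega

/-- `F` extends one side of the separation, and `G` extends the side opposite to `F`. Thus `F ∪ G =
E`, and `F`, `G` form a modular pair. -/
lemma exists_meetInside_of_not_connBetween [M.Finite] (hM : M.ConnBetween ∅ M.E)
    (hZ : M.ConnBetween ∅ Z) (hflat : M.IsFlat Z) (h0 : 0 < M.rk Z) (h1 : M.rk Z < Z.ncard)
    (h : ¬ M.ConnBetween Z M.E) :
    ∃ F G, M.IsSplitSet F ∧ M.IsSplitSet G ∧ F ≠ G ∧ M.MeetInside F G := by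
  unfold ConnBetween at h
  push Not at h
  obtain ⟨Y, hZY, hYE, hY⟩ := h
  obtain ⟨F, -, hF, hsF⟩ := IsSeparator.exists_isSplitSet hM hZ hflat h0 h1
    (Y := Y) ⟨hZY, hYE, by omega⟩
  obtain ⟨G, hFG, hG, hsG⟩ := hF.symm.exists_isSplitSet hM hZ hflat h0 h1
  have hZF := hF.ssubset_left.subset
  have hFE := hsF.subset_ground
  have hGE := hsG.subset_ground
  have hFE' := hF.ssubset_right.not_subset
  have hGE' := hG.ssubset_right.not_subset
  refine ⟨F, G, hsF, hsG, ?_, ?_⟩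
  · rintro rfl
    exact hFE' (by grind)
  have hI : F ∩ G ⊆ M.E := Set.inter_subset_left.trans hFE
  have hZI : Z ⊆ F ∩ G := Set.subset_inter hZF hG.ssubset_left.subset
  have i1 := M.rk_mono hZI
  have i2 := rk_lt_ncard_mono hI hZI h1
  have i3 := M.rk_inter_add_rk_union_le F G
  rw [show F ∪ G = M.E by grind] at i3
  have i4 := M.rk_inter_add_rk_union_le (F ∩ G) (Z ∪ (M.E \ F))
  rw [show F ∩ G ∩ (Z ∪ (M.E \ F)) = Z by grind,
    show F ∩ G ∪ (Z ∪ (M.E \ F)) = G by grind] at i4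
  have i5 := hF.rk_add_le
  have i6 : M.rk (F ∩ G) + M.rk M.E = M.rk F + M.rk G := by omega
  have i6' : (M.rk (F ∩ G) : ℝ) + M.rk M.E = M.rk F + M.rk G := by exact_mod_cast i6
  have f1 : (M.rk F : ℝ) < M.rk M.E := by exact_mod_cast hsF.rk_lt_rk
  have g1 : (M.rk G : ℝ) < M.rk M.E := by exact_mod_cast hsG.rk_lt_rk
  have f2 : (M.rk M.E : ℝ) < M.rk F + (M.E \ F).ncard := by exact_mod_cast hsF.rk_ground_lt
  have g2 : (M.rk M.E : ℝ) < M.rk G + (M.E \ G).ncard := by exact_mod_cast hsG.rk_ground_lt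
  -- The sums over the complements are what `x(F) = r(F)` and `x(G) = r(G)` demand; modularity
  -- (`i6`) makes the total `r(M)`.
  obtain ⟨x, hx, x1, x2, x3⟩ := M.exists_groundSum_eq (A := F ∩ G) (B := M.E \ F) (C := M.E \ G)
    (a := M.rk (F ∩ G)) (b := M.rk M.E - M.rk F) (c := M.rk M.E - M.rk G)
    (by grind) (by grind) (by grind)
    (by grind) (by exact_mod_cast h0.trans_le i1) (by exact_mod_cast i2)
    (by linarith) (by linarith) (by linarith) (by linarith)
  have s1 := groundSum_add_sdiff hFE x
  have s2 := groundSum_add_sdiff hGE x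
  have s3 := groundSum_union_add_inter F G x
  rw [show F ∪ G = M.E by grind] at s3
  exact ⟨x, hx, by linarith, by linarith, by linarith⟩

/-- Prescribe sums on the blocks `G`, `F \ G` and `E \ F`. The strict bound `r(F) - r(G) < |F \ G|`
comes from connectivity of `M|F`. -/
lemma exists_meetInside_of_ssubset [M.Finite] (hF : M.IsSplitSet F) (hG : M.IsSplitSet G)
    (hGF : G ⊂ F) : M.MeetInside G F := by
  have h1 := hG.isFlat.rk_lt_rk hF.subset_ground hGF
  have hGne : G.Nonempty := by
    rw [Set.nonempty_iff_ne_empty]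
    rintro rfl
    simpa using hG.rk_pos
  have h2 := hF.conn_restrict.rk_lt_add hGF hGne
  have h3 := M.rk_le_ncard (X := F \ G) (Set.sdiff_subset.trans hF.subset_ground)
  have k1 : (0 : ℝ) < M.rk G := by exact_mod_cast hG.rk_pos
  have k2 : (M.rk G : ℝ) < G.ncard := by exact_mod_cast hG.rk_lt_ncard
  have k3 : (M.rk G : ℝ) < M.rk F := by exact_mod_cast h1
  have k4 : (M.rk F : ℝ) < M.rk G + (F \ G).ncard := by exact_mod_cast (by omega)
  have k5 : (M.rk F : ℝ) < M.rk M.E := by exact_mod_cast hF.rk_lt_rk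
  have k6 : (M.rk M.E : ℝ) < M.rk F + (M.E \ F).ncard := by exact_mod_cast hF.rk_ground_lt
  have hFE := hF.subset_ground
  have hGF' := hGF.subset
  obtain ⟨x, hx, x1, x2, x3⟩ := M.exists_groundSum_eq (A := G) (B := F \ G) (C := M.E \ F)
    (a := M.rk G) (b := M.rk F - M.rk G) (c := M.rk M.E - M.rk F)
    (by grind) (by grind) (by grind)
    (by grind) k1 k2 (by linarith) (by linarith) (by linarith) (by linarith)
  have s1 := groundSum_add_sdiff hFE x
  have s2 := groundSum_add_sdiff hGF' x
  exact ⟨x, hx, by linarith, by linarith, by linarith⟩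

/-! ### Circuits of small rank as obstructions to uniformity. -/

lemma isUniform_restrict_of_forall_isCircuit [M.Finite] (hZ : Z ⊆ M.E)
    (h : ∀ C ⊆ Z, M.IsCircuit C → M.rk Z ≤ M.rk C) : (M.restrict Z).IsUniform := by
  refine ⟨M.rk Z, fun I hI ↦ ?_⟩
  have hI' : I ⊆ Z := hI
  have hfin := M.ground_finite.subset (hI'.trans hZ)
  rw [restrict_indep_iff, and_iff_left hI', ← hfin.cast_ncard_eq, Nat.cast_le]
  refine ⟨fun h' ↦ h'.ncard_le_rk hI', fun hcard ↦ ?_⟩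
  rw [indep_iff_forall_subset_not_isCircuit (hI'.trans hZ)]
  intro C hCI hC
  -- A circuit inside `I` would have `r(Z) + 1` or more elements, too many for `I`.
  have h1 := h C (hCI.trans hI') hC
  have h2 := hC.rk_add_one
  have h3 := Set.ncard_le_ncard hCI hfin
  omega

/-- A partition that splits `C` inherits defect at least one from `C`. Otherwise one part contains
`C`, so has full rank, and the other has positive rank since `M` has no loops. -/
lemma connBetween_closure_of_isCircuit [M.Finite] (hM : M.ConnBetween ∅ M.E)
    (h0 : 0 < M.rk M.E) (hC : M.IsCircuit C) : M.ConnBetween ∅ (M.closure C) := by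
  have hCc : C ⊆ M.closure C := M.subset_closure C hC.subset_ground
  have aux : ∀ B ⊆ M.closure C, B.Nonempty → C ⊆ M.closure C \ B →
      M.rk (M.closure C) < M.rk B + M.rk (M.closure C \ B) := by
    intro B hB hne hCB
    have h1 := hM.rk_pos h0 (hB.trans (M.closure_subset_ground C)) hne
    have h2 := M.rk_mono hCB
    rw [M.rk_closure]
    omega
  rw [connBetween_empty_iff]
  intro X hX hne
  by_cases h1 : C ∩ X = ∅
  · exact aux X hX.subset hne
      (Set.subset_sdiff.2 ⟨hCc, Set.disjoint_iff_inter_eq_empty.2 h1⟩)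
  by_cases h2 : C \ X = ∅
  · have := aux (M.closure C \ X) Set.sdiff_subset (Set.sdiff_nonempty.2 hX.not_subset)
      (by rwa [Set.sdiff_sdiff_cancel_left hX.subset, ← Set.sdiff_eq_empty])
    rw [Set.sdiff_sdiff_cancel_left hX.subset] at this
    omega
  have h3 := M.rk_add_rk_sdiff_add_rk_inter_le hX.subset hCc
  have h4 := (hC.ssubset_indep (X := C \ X) (by grind)).ncard_eq_rk
  have h5 := (hC.ssubset_indep (X := C ∩ X) (by grind)).ncard_eq_rk
  have h6 := hC.rk_add_one
  have h7 := Set.ncard_inter_add_ncard_sdiff_eq_ncard C X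
    (M.ground_finite.subset hC.subset_ground)
  omega

lemma isSplitSet_of_forall_not_meetInside [M.Finite] (hM : M.ConnBetween ∅ M.E)
    (hsplit : ∀ F G, M.IsSplitSet F → M.IsSplitSet G → F ≠ G → ¬ M.MeetInside F G)
    (hZ : M.ConnBetween ∅ Z) (hflat : M.IsFlat Z) (h0 : 0 < M.rk Z) (h1 : M.rk Z < Z.ncard)
    (h2 : M.rk Z < M.rk M.E) : M.IsSplitSet Z := by
  refine .of_connBetween hM hflat.subset_ground hZ ?_ h0 h1 h2
  by_contra hcon
  obtain ⟨F, G, hF, hG, hne, hmeet⟩ :=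
    exists_meetInside_of_not_connBetween hM hZ hflat h0 h1 hcon
  exact hsplit F G hF hG hne hmeet

lemma isUniform_restrict_of_forall_not_meetInside [M.Finite] (hM : M.ConnBetween ∅ M.E)
    (hsplit : ∀ F G, M.IsSplitSet F → M.IsSplitSet G → F ≠ G → ¬ M.MeetInside F G)
    (hZ : M.ConnBetween ∅ Z) (hflat : M.IsFlat Z) (h0 : 0 < M.rk Z) (h1 : M.rk Z < Z.ncard)
    (h2 : M.rk Z < M.rk M.E) : (M.restrict Z).IsUniform := by
  have hs := isSplitSet_of_forall_not_meetInside hM hsplit hZ hflat h0 h1 h2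
  refine isUniform_restrict_of_forall_isCircuit hflat.subset_ground fun C hCZ hC ↦ ?_
  by_contra! hlt
  have hCE := hC.subset_ground
  have hcl : M.closure C ⊆ Z := hflat.closure ▸ M.closure_subset_closure hCZ
  have hk := M.rk_closure C
  have hC0 : 0 < M.rk C := hZ.rk_pos h0 hCZ hC.nonempty
  have hs' := isSplitSet_of_forall_not_meetInside hM hsplit (Z := M.closure C)
    (connBetween_closure_of_isCircuit hM (by omega) hC) (M.isFlat_closure C) (by omega)
    (rk_lt_ncard_mono (M.closure_subset_ground C) (M.subset_closure C)
      (by have := hC.rk_add_one; omega)) (by omega)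
  have hss : M.closure C ⊂ Z := hcl.ssubset_of_ne fun h ↦ by rw [h] at hk; omega
  exact hsplit _ _ hs' hs hss.ne (exists_meetInside_of_ssubset hs hs' hss)

end Matroid

/-! ### Polytopes and their exposed faces -/

section Polytope

set_option linter.unusedSectionVars false

open Set

variable {V : Type*} [AddCommGroup V] [Module ℝ V] [TopologicalSpace V]
  [IsTopologicalAddGroup V] [ContinuousSMul ℝ V] [T2Space V] [LocallyConvexSpace ℝ V]
  {P Q Q₁ Q₂ F G : Set V} {x c : V}

lemma IsPolytope.isCompact (h : IsPolytope P) : IsCompact P := by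
  obtain ⟨X, hX, rfl⟩ := h
  exact hX.isCompact_convexHull ℝ

lemma IsPolytope.convex (h : IsPolytope P) : Convex ℝ P := by
  obtain ⟨X, hX, rfl⟩ := h
  exact convex_convexHull ℝ X

lemma IsPolytope.finite_extremePoints (h : IsPolytope P) : (P.extremePoints ℝ).Finite := by
  obtain ⟨X, hX, rfl⟩ := h
  exact hX.subset extremePoints_convexHull_subset

/-- Krein–Milman, where the closure is superfluous because the hull of a finite set is closed. -/
lemma convexHull_extremePoints_of_finite (hc : IsCompact P) (hconv : Convex ℝ P)
    (hfin : (P.extremePoints ℝ).Finite) : convexHull ℝ (P.extremePoints ℝ) = P := by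
  rw [← (hfin.isClosed_convexHull ℝ).closure_eq]
  exact closure_convexHull_extremePoints hc hconv

lemma IsPolytope.convexHull_extremePoints (h : IsPolytope P) :
    convexHull ℝ (P.extremePoints ℝ) = P :=
  convexHull_extremePoints_of_finite h.isCompact h.convex h.finite_extremePoints

lemma IsPolytope.convexHull_face (h : IsPolytope P) (hF : IsExposed ℝ P F) :
    convexHull ℝ (F.extremePoints ℝ) = F :=
  convexHull_extremePoints_of_finite (hF.isCompact h.isCompact) (hF.convex h.convex)
    (h.finite_extremePoints.subset hF.isExtreme.extremePoints_subset_extremePoints)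

lemma IsPolytope.face (h : IsPolytope P) (hF : IsExposed ℝ P F) : IsPolytope F :=
  ⟨F.extremePoints ℝ,
    h.finite_extremePoints.subset hF.isExtreme.extremePoints_subset_extremePoints,
    (h.convexHull_face hF).symm⟩

lemma le_of_mem_convexHull {X : Set V} (l : V →L[ℝ] ℝ) {b : ℝ} (h : ∀ v ∈ X, l v ≤ b)
    (hx : x ∈ convexHull ℝ X) : l x ≤ b :=
  convexHull_min (t := {y | l y ≤ b}) h (convex_halfSpace_le l.toLinearMap.isLinear b) hx

lemma eq_of_mem_convexHull {X : Set V} (l : V →L[ℝ] ℝ) {b : ℝ} (h : ∀ v ∈ X, l v = b)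
    (hx : x ∈ convexHull ℝ X) : l x = b :=
  convexHull_min (t := {y | l y = b}) h (convex_hyperplane l.toLinearMap.isLinear b) hx

/-- A face of a face of a polytope is a face. -/
lemma IsPolytope.isExposed_trans (h : IsPolytope P) (hF : IsExposed ℝ P F)
    (hG : IsExposed ℝ F G) : IsExposed ℝ P G := by
  rintro ⟨g, hg⟩
  have hgF := hG.subset hg
  obtain ⟨l₁, h₁⟩ := hF ⟨g, hgF⟩
  obtain ⟨l₂, h₂⟩ := hG ⟨g, hg⟩
  have hgP := hF.subset hgF
  have memF : ∀ y, y ∈ F ↔ y ∈ P ∧ ∀ z ∈ P, l₁ z ≤ l₁ y := fun y ↦ by rw [h₁]; rfl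
  have memG : ∀ y, y ∈ G ↔ y ∈ F ∧ ∀ z ∈ F, l₂ z ≤ l₂ y := fun y ↦ by rw [h₂]; rfl
  have le₁ : ∀ y ∈ P, l₁ y ≤ l₁ g := ((memF g).1 hgF).2
  have le₂ : ∀ y ∈ F, l₂ y ≤ l₂ g := ((memG g).1 hg).2
  have ltF : ∀ y ∈ P, y ∉ F → l₁ y < l₁ g := fun y hy hyF ↦ by
    by_contra! hcon
    exact hyF ((memF y).2 ⟨hy, fun z hz ↦ (le₁ z hz).trans hcon⟩)
  have eqF : ∀ y ∈ F, l₁ y = l₁ g := fun y hy ↦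
    le_antisymm (le₁ y (hF.subset hy)) (((memF y).1 hy).2 g hgP)
  have eqG : ∀ y ∈ G, l₂ y = l₂ g := fun y hy ↦
    le_antisymm (le₂ y (hG.subset hy)) (((memG y).1 hy).2 g hgF)
  -- `N` bounds the ratios of `l₂`-gain to `l₁`-loss over the finitely many vertices. With weight `N
  -- + 1` on `l₁`, every vertex outside `G` falls strictly below `g`.
  obtain ⟨N, hN⟩ := (h.finite_extremePoints.image
    fun v ↦ (l₂ v - l₂ g) / (l₁ g - l₁ v)).bddAbove
  set L : V →L[ℝ] ℝ := (N + 1) • l₁ + l₂ with hL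
  have hLy : ∀ y, L y = (N + 1) * l₁ y + l₂ y := fun y ↦ by simp [hL]
  have key : ∀ v ∈ P.extremePoints ℝ, v ∉ G → L v < L g := by
    intro v hv hvG
    have hvP := extremePoints_subset hv
    rw [hLy, hLy]
    by_cases hvF : v ∈ F
    · have : l₂ v < l₂ g := by
        by_contra! hcon
        exact hvG ((memG v).2 ⟨hvF, fun z hz ↦ (le₂ z hz).trans hcon⟩)
      rw [eqF v hvF]
      linarith
    · have h1 := hN (mem_image_of_mem _ hv)
      have h2 := ltF v hvP hvF
      rw [div_le_iff₀ (by linarith)] at h1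
      nlinarith
  have eqL : ∀ y ∈ G, L y = L g := fun y hy ↦ by
    rw [hLy, hLy, eqF y (hG.subset hy), eqG y hy]
  have leL : ∀ y ∈ P, L y ≤ L g := by
    intro y hy
    rw [← h.convexHull_extremePoints] at hy
    refine le_of_mem_convexHull L (fun v hv ↦ ?_) hy
    by_cases hvG : v ∈ G
    · exact (eqL v hvG).le
    · exact (key v hv hvG).le
  refine ⟨L, Subset.antisymm (fun y hy ↦ ⟨hF.subset (hG.subset hy), fun z hz ↦ ?_⟩) ?_⟩
  · rw [eqL y hy]
    exact leL z hz
  · have hexp : IsExposed ℝ P {x | x ∈ P ∧ ∀ y ∈ P, L y ≤ L x} := fun _ ↦ ⟨L, rfl⟩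
    rw [← h.convexHull_face hexp]
    refine convexHull_min (fun v hv ↦ ?_) (hG.convex (hF.convex h.convex))
    have hvP := hexp.isExtreme.extremePoints_subset_extremePoints hv
    have hv' := extremePoints_subset hv
    by_contra hvG
    exact (key v hvP hvG).not_ge (hv'.2 g hgP)

/-! ### Splits -/

/-- `F` and `G` cut out faces of the common wall `Q₁ ∩ Q₂`; the intersection of these is a face of
the wall, hence of `Q₁`, hence of `F`. -/
lemma isExposed_inter_of_union (h₁ : IsPolytope Q₁) (hR₁ : IsExposed ℝ Q₁ (Q₁ ∩ Q₂))
    (hR₂ : IsExposed ℝ Q₂ (Q₁ ∩ Q₂)) (hF : IsExposed ℝ Q₁ F) (hG : IsExposed ℝ Q₂ G) :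
    IsExposed ℝ F (F ∩ G) := by
  have hF' : IsExposed ℝ (Q₁ ∩ Q₂) (F ∩ (Q₁ ∩ Q₂)) :=
    (hF.inter hR₁).mono inter_subset_left inter_subset_right
  have hG' : IsExposed ℝ (Q₁ ∩ Q₂) (G ∩ (Q₁ ∩ Q₂)) :=
    (hG.inter hR₂).mono inter_subset_right inter_subset_right
  have h := hF'.inter hG'
  rw [show F ∩ (Q₁ ∩ Q₂) ∩ (G ∩ (Q₁ ∩ Q₂)) = F ∩ G by
    have := hF.subset
    have := hG.subset
    grind] at h
  exact (h₁.isExposed_trans hR₁ h).mono hF.subset inter_subset_left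

/-- The split consists of all faces of `Q₁` and of `Q₂`. -/
lemma isSplitHyperplane_of_union (h₁ : IsPolytope Q₁) (h₂ : IsPolytope Q₂) (hP : Q₁ ∪ Q₂ = P)
    (hR₁ : IsExposed ℝ Q₁ (Q₁ ∩ Q₂)) (hR₂ : IsExposed ℝ Q₂ (Q₁ ∩ Q₂))
    (he₁ : Q₁.extremePoints ℝ ⊆ P.extremePoints ℝ) (he₂ : Q₂.extremePoints ℝ ⊆ P.extremePoints ℝ)
    (hn₁ : ¬ Q₁ ⊆ Q₂) (hn₂ : ¬ Q₂ ⊆ Q₁) : IsSplitHyperplane P (affineSpan ℝ (Q₁ ∩ Q₂)) := by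
  set C : Set (Set V) := {F | IsExposed ℝ Q₁ F ∨ IsExposed ℝ Q₂ F} with hC
  have m₁ : Maximal (fun R ↦ R ∈ C) Q₁ := by
    refine ⟨Or.inl (.refl _), ?_⟩
    rintro R (hR | hR) hQR
    · exact hR.subset
    · exact absurd (hQR.trans hR.subset) hn₁
  have m₂ : Maximal (fun R ↦ R ∈ C) Q₂ := by
    refine ⟨Or.inr (.refl _), ?_⟩
    rintro R (hR | hR) hQR
    · exact absurd (hQR.trans hR.subset) hn₂
    · exact hR.subset
  have hne : Q₁ ≠ Q₂ := fun h ↦ hn₁ h.subset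
  have hR₁' : IsExposed ℝ Q₁ (Q₂ ∩ Q₁) := by rwa [inter_comm]
  have hR₂' : IsExposed ℝ Q₂ (Q₂ ∩ Q₁) := by rwa [inter_comm]
  have inter : ∀ A ∈ C, ∀ B ∈ C, IsExposed ℝ A (A ∩ B) := by
    rintro A (hA | hA) B (hB | hB)
    · exact (hA.inter hB).mono hA.subset inter_subset_left
    · exact isExposed_inter_of_union h₁ hR₁ hR₂ hA hB
    · exact isExposed_inter_of_union h₂ hR₂' hR₁' hA hB
    · exact (hA.inter hB).mono hA.subset inter_subset_left
  refine ⟨C, ⟨?_, Or.inl isExposed_empty, ?_, ?_, ?_, ?_, ?_⟩, Q₁, Q₂, m₁, m₂, hne, rfl⟩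
  · rintro Q (hQ | hQ)
    · exact h₁.face hQ
    · exact h₂.face hQ
  · rintro Q (hQ | hQ)
    · exact hQ.isExtreme.extremePoints_subset_extremePoints.trans he₁
    · exact hQ.isExtreme.extremePoints_subset_extremePoints.trans he₂
  · rintro Q (hQ | hQ) F hF
    · exact Or.inl (h₁.isExposed_trans hQ hF)
    · exact Or.inr (h₂.isExposed_trans hQ hF)
  · intro A hA B hB _
    refine ⟨inter A hA B hB, ?_⟩
    rw [inter_comm]
    exact inter B hB A hA
  · refine Subset.antisymm (sUnion_subset ?_) ?_
    · rintro Q (hQ | hQ)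
      · exact hQ.subset.trans (hP ▸ subset_union_left)
      · exact hQ.subset.trans (hP ▸ subset_union_right)
    · rw [← hP]
      exact union_subset (subset_sUnion_of_mem m₁.prop) (subset_sUnion_of_mem m₂.prop)
  · rw [← ncard_pair hne]
    congr 1
    refine Subset.antisymm ?_ ?_
    · rintro R hR
      rcases hR.prop with h | h
      · exact Or.inl (hR.eq_of_le m₁.prop h.subset)
      · exact Or.inr (hR.eq_of_le m₂.prop h.subset)
    · rintro R (rfl | rfl)
      exacts [m₁, m₂]

/-- Each cell is the hull of some vertices of `P`, so there are finitely many cells and each lies in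
one of the two maximal ones. -/
lemma IsSplitOf.union_eq {C : Set (Set V)} (hP : IsPolytope P) (h : IsSplitOf P C)
    (h₁ : Maximal (fun R ↦ R ∈ C) Q₁) (h₂ : Maximal (fun R ↦ R ∈ C) Q₂) (hne : Q₁ ≠ Q₂) :
    Q₁ ∪ Q₂ = P := by
  have hfin : C.Finite := by
    refine (hP.finite_extremePoints.finite_subsets.image fun X ↦ convexHull ℝ X).subset ?_
    intro Q hQ
    exact ⟨Q.extremePoints ℝ, h.vertices_subset Q hQ, (h.isPolytope Q hQ).convexHull_extremePoints⟩
  have heq : ({Q₁, Q₂} : Set (Set V)) = {Q | Maximal (fun R ↦ R ∈ C) Q} := by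
    refine eq_of_subset_of_ncard_le ?_ (by rw [h.two_maximal, ncard_pair hne])
      (hfin.subset fun Q hQ ↦ hQ.prop)
    rintro Q (rfl | rfl)
    exacts [h₁, h₂]
  rw [← h.sUnion_eq]
  refine Subset.antisymm
    (union_subset (subset_sUnion_of_mem h₁.prop) (subset_sUnion_of_mem h₂.prop)) ?_
  refine sUnion_subset fun Q hQ ↦ ?_
  obtain ⟨R, hQR, hR⟩ := hfin.exists_le_maximal hQ
  have : R ∈ ({Q₁, Q₂} : Set (Set V)) := heq ▸ hR
  rcases this with rfl | rfl
  · exact hQR.trans subset_union_left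
  · exact hQR.trans subset_union_right

/-- A split hyperplane is not a supporting hyperplane of a facet. -/
lemma IsSplitHyperplane.exists_lt {H : AffineSubspace ℝ V} (hP : IsPolytope P)
    (h : IsSplitHyperplane P H) (l : V →L[ℝ] ℝ) {b : ℝ} (hH : ∀ x ∈ H, l x = b)
    (hu : x ∈ P) (hxb : l x < b) : ∃ y ∈ P, b < l y := by
  obtain ⟨C, hC, Q₁, Q₂, h₁, h₂, hne, rfl⟩ := h
  by_contra! hle
  have hun := hC.union_eq hP h₁ h₂ hne
  -- If `l ≤ b` on `P`, then `U` is dense in `P`, connected, and disjoint from the wall. It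
  -- therefore lies in one closed cell, which must then be all of `P`.
  set U : Set V := {y | y ∈ P ∧ l y < b} with hU
  have hUconv : Convex ℝ U := hP.convex.inter (convex_halfSpace_lt l.toLinearMap.isLinear b)
  have aux : ∀ Q, IsClosed Q → U ⊆ Q → P ⊆ Q := by
    intro Q hQ hUQ y hy
    have hseg : openSegment ℝ x y ⊆ U := by
      intro z hz
      refine ⟨hP.convex.openSegment_subset hu hy hz, ?_⟩
      obtain ⟨s, t, hs, ht, hst, rfl⟩ := hz
      have := hle y hy
      simp only [map_add, map_smul, smul_eq_mul]
      have e : b = s * b + t * b := by rw [← add_mul, hst, one_mul]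
      have := mul_le_mul_of_nonneg_left this ht.le
      have := mul_lt_mul_of_pos_left hxb hs
      linarith
    have hyc : y ∈ closure (openSegment ℝ x y) := by
      rw [closure_openSegment]
      exact right_mem_segment ℝ x y
    exact closure_minimal (hseg.trans hUQ) hQ hyc
  have c₁ := (hC.isPolytope _ h₁.prop).isCompact.isClosed
  have c₂ := (hC.isPolytope _ h₂.prop).isCompact.isClosed
  have s₁ : Q₁ ⊆ P := hun ▸ subset_union_left
  have s₂ : Q₂ ⊆ P := hun ▸ subset_union_right
  have hUQ : U ⊆ Q₁ ∪ Q₂ := hun ▸ fun y hy ↦ hy.1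
  by_cases n₁ : (U ∩ Q₁).Nonempty
  · by_cases n₂ : (U ∩ Q₂).Nonempty
    · obtain ⟨y, hyU, hyQ⟩ :=
        isPreconnected_closed_iff.1 hUconv.isPreconnected _ _ c₁ c₂ hUQ n₁ n₂
      exact hyU.2.ne (hH y (subset_affineSpan ℝ _ hyQ))
    · have hs : U ⊆ Q₁ := fun y hy ↦ (hUQ hy).resolve_right fun hy' ↦ n₂ ⟨y, hy, hy'⟩
      exact hne (h₂.eq_of_le h₁.prop (s₂.trans (aux Q₁ c₁ hs))).symm
  · have hs : U ⊆ Q₂ := fun y hy ↦ (hUQ hy).resolve_left fun hy' ↦ n₁ ⟨y, hy, hy'⟩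
    exact hne (h₁.eq_of_le h₂.prop (s₁.trans (aux Q₂ c₂ hs)))

/-! ### The intrinsic interior -/

lemma exists_add_smul_sub_mem_of_mem_intrinsicInterior {s : Set V}
    (hx : x ∈ intrinsicInterior ℝ s) (hc : c ∈ s) : ∃ ε > (0 : ℝ), x + ε • (x - c) ∈ s := by
  obtain ⟨y, hy, rfl⟩ := mem_intrinsicInterior.1 hx
  -- The negative parameter gives `y + t • (y - c)`, a move away from `c`.
  let f : ℝ → affineSpan ℝ s := fun t ↦
    ⟨AffineMap.lineMap (y : V) c (-t), AffineMap.lineMap_mem _ y.2 (subset_affineSpan ℝ s hc)⟩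
  have hf : Continuous f := by
    refine Continuous.subtype_mk ?_ _
    simp only [AffineMap.lineMap_apply_module]
    fun_prop
  have hf0 : f 0 = y := by simp [f]
  have hnhds : f ⁻¹' ((↑) ⁻¹' s) ∈ nhds (0 : ℝ) :=
    hf.continuousAt.preimage_mem_nhds (by rw [hf0]; exact mem_interior_iff_mem_nhds.1 hy)
  obtain ⟨δ, hδ, hball⟩ := Metric.mem_nhds_iff.1 hnhds
  refine ⟨δ / 2, by positivity, ?_⟩
  have h1 : f (δ / 2) ∈ ((↑) ⁻¹' s : Set (affineSpan ℝ s)) :=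
    hball (by rw [mem_ball_zero_iff, Real.norm_eq_abs, abs_of_pos (by positivity)]; linarith)
  have h2 : (f (δ / 2) : V) = y + (δ / 2) • ((y : V) - c) := by
    simp only [f, AffineMap.lineMap_apply_module]
    module
  rw [← h2]
  exact h1

lemma mem_intrinsicInterior_inter {A : AffineSubspace ℝ V} {K U : Set V} (hU : IsOpen U)
    (hUK : U ⊆ K) (hxA : x ∈ A) (hxU : x ∈ U) : x ∈ intrinsicInterior ℝ ((A : Set V) ∩ K) := by
  refine mem_intrinsicInterior.2
    ⟨⟨x, subset_affineSpan ℝ _ ⟨hxA, hUK hxU⟩⟩, mem_interior.2 ⟨Subtype.val ⁻¹' U, ?_, ?_, ?_⟩, rfl⟩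
  · rintro ⟨z, hz⟩ hzU
    exact ⟨affineSpan_le.2 inter_subset_left hz, hUK hzU⟩
  · exact hU.preimage continuous_subtype_val
  · exact hxU

end Polytope

/-! ### Slices of the hypersimplex -/

section Hypersimplex

set_option linter.unusedSectionVars false

open Set

variable {ι : Type*} [Finite ι] {F S T : Set ι} {r p q : ℕ} {x : ι → ℝ}

/-- The part of the hypersimplex on which the coordinate sum over `F` lies between `p` and `q`. -/
def hypersimplexSlice (F : Set ι) (r p q : ℕ) : Set (ι → ℝ) :=
  {x | x ∈ Icc 0 1 ∧ coordSum univ x = r ∧ p ≤ coordSum F x ∧ coordSum F x ≤ q}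

lemma coordSum_single [DecidableEq ι] (S : Set ι) (i : ι) [Decidable (i ∈ S)] (c : ℝ) :
    coordSum S (Pi.single i c) = if i ∈ S then c else 0 := by
  split_ifs with h
  · rw [← coordSum_add_sdiff (singleton_subset_iff.2 h),
      coordSum_congr (x := Pi.single i c) (S := S \ {i}) (y := fun _ ↦ 0)
        fun j hj ↦ by rw [Pi.single_apply]; exact if_neg hj.2,
      coordSum_const, coordSum_apply, finsum_mem_singleton]
    simp
  · rw [coordSum_congr (y := fun _ ↦ 0) fun j hj ↦ by
      rw [Pi.single_apply, if_neg]; rintro rfl; exact h hj, coordSum_const]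
    simp

lemma exists_int_eq_coordSum (h : ∀ i ∈ S, x i = 0 ∨ x i = 1) :
    ∃ n : ℤ, coordSum S x = n := by
  classical
  refine ⟨(S ∩ {i | x i = 1}).ncard, ?_⟩
  rw [Int.cast_natCast, ← coordSum_indicator]
  refine coordSum_congr fun i hi ↦ ?_
  rcases h i hi with h | h <;> simp [h]

lemma isCompact_hypersimplexSlice (F : Set ι) (r p q : ℕ) :
    IsCompact (hypersimplexSlice F r p q) := by
  have : hypersimplexSlice F r p q = Icc 0 1 ∩ ({x | coordSum univ x = r} ∩
      ({x | (p : ℝ) ≤ coordSum F x} ∩ {x | coordSum F x ≤ q})) := rfl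
  rw [this]
  refine isCompact_Icc.inter_right (.inter ?_ (.inter ?_ ?_))
  · exact isClosed_eq (coordSum univ).continuous continuous_const
  · exact isClosed_le continuous_const (coordSum F).continuous
  · exact isClosed_le (coordSum F).continuous continuous_const

lemma convex_hypersimplexSlice (F : Set ι) (r p q : ℕ) : Convex ℝ (hypersimplexSlice F r p q) :=
  (convex_Icc 0 1).inter ((convex_hyperplane (coordSum univ).toLinearMap.isLinear _).inter
    ((convex_halfSpace_ge (coordSum F).toLinearMap.isLinear _).inter
      (convex_halfSpace_le (coordSum F).toLinearMap.isLinear _)))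

lemma not_mem_extremePoints_of_perturb {V : Type*} [AddCommGroup V] [Module ℝ V] {A : Set V}
    {x v : V} (hv : v ≠ 0) (h1 : x + v ∈ A) (h2 : x - v ∈ A) : x ∉ A.extremePoints ℝ := by
  intro hx
  have := hx.2 h1 h2 ⟨1 / 2, 1 / 2, by norm_num, by norm_num, by norm_num, by module⟩
  exact hv (by simpa using this)

/-- Moving `ε` between coordinates `i` and `j` keeps the total. It keeps the sum over `F` if both
lie on the same side of `F`; otherwise slack in both bounds absorbs the change. -/
lemma not_mem_extremePoints_of_fractional (hx : x ∈ hypersimplexSlice F r p q) {i j : ι}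
    (hij : i ≠ j) (hi : 0 < x i ∧ x i < 1) (hj : 0 < x j ∧ x j < 1)
    (h : (i ∈ F ↔ j ∈ F) ∨ (p < coordSum F x ∧ coordSum F x < q)) :
    x ∉ (hypersimplexSlice F r p q).extremePoints ℝ := by
  classical
  obtain ⟨ε, hε, h1, h2, h3, h4, h5⟩ : ∃ ε > (0 : ℝ), ε ≤ x i ∧ ε ≤ 1 - x i ∧ ε ≤ x j ∧
      ε ≤ 1 - x j ∧ ((p < coordSum F x ∧ coordSum F x < q) →
        ε ≤ coordSum F x - p ∧ ε ≤ q - coordSum F x) := by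
    by_cases hF : p < coordSum F x ∧ coordSum F x < q
    · refine ⟨min (min (min (x i) (1 - x i)) (min (x j) (1 - x j)))
        (min (coordSum F x - p) (q - coordSum F x)), ?_, ?_⟩
      · simp only [gt_iff_lt, lt_min_iff, sub_pos]
        tauto
      · simp only [min_le_iff, le_refl, true_or, or_true, implies_true, and_self]
    · refine ⟨min (min (x i) (1 - x i)) (min (x j) (1 - x j)), ?_, ?_⟩
      · simp only [gt_iff_lt, lt_min_iff, sub_pos]
        tauto
      · simp only [min_le_iff, le_refl, true_or, or_true, true_and]
        tauto
  obtain ⟨⟨hx0, hx1⟩, hxr, hxp, hxq⟩ := hx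
  set v : ι → ℝ := Pi.single i ε - Pi.single j ε with hv
  have vF : |coordSum F v| ≤ ε := by
    rw [hv, map_sub, coordSum_single, coordSum_single]
    split_ifs <;> simp [abs_of_pos hε, hε.le]
  have vF' : (i ∈ F ↔ j ∈ F) → coordSum F v = 0 := fun hiff ↦ by
    rw [hv, map_sub, coordSum_single, coordSum_single]
    simp [hiff]
  have vU : coordSum univ v = 0 := by
    rw [hv, map_sub, coordSum_single, coordSum_single]
    simp
  have vk : ∀ k, -x k ≤ v k ∧ v k ≤ x k ∧ x k + v k ≤ 1 ∧ x k - v k ≤ 1 := by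
    intro k
    have hk0 := hx0 k
    have hk1 := hx1 k
    simp only [Pi.zero_apply, Pi.one_apply] at hk0 hk1
    have : v k = (if k = i then ε else 0) - (if k = j then ε else 0) := by
      simp [hv, Pi.single_apply]
    rw [this]
    split_ifs with e1 e2 e2
    · exact absurd (e1.symm.trans e2) hij
    · subst e1
      refine ⟨?_, ?_, ?_, ?_⟩ <;> linarith
    · subst e2
      refine ⟨?_, ?_, ?_, ?_⟩ <;> linarith
    · refine ⟨?_, ?_, ?_, ?_⟩ <;> linarith
  have hpq : (p : ℝ) ≤ coordSum F x + coordSum F v ∧ coordSum F x + coordSum F v ≤ q ∧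
      (p : ℝ) ≤ coordSum F x - coordSum F v ∧ coordSum F x - coordSum F v ≤ q := by
    rcases h with h | h
    · rw [vF' h]
      simp [hxp, hxq]
    · obtain ⟨a1, a2⟩ := h5 h
      obtain ⟨a3, a4⟩ := abs_le.1 vF
      refine ⟨?_, ?_, ?_, ?_⟩ <;> linarith
  refine not_mem_extremePoints_of_perturb (v := v) ?_ ?_ ?_
  · intro h0
    have := congrFun h0 i
    simp [hv, hij] at this
    exact hε.ne' this
  · refine ⟨⟨fun k ↦ ?_, fun k ↦ ?_⟩, ?_, ?_, ?_⟩
    · have := vk k; simp only [Pi.zero_apply, Pi.add_apply]; linarith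
    · have := vk k; simp only [Pi.one_apply, Pi.add_apply]; linarith
    · rw [map_add, vU, hxr, add_zero]
    · rw [map_add]; exact hpq.1
    · rw [map_add]; exact hpq.2.1
  · refine ⟨⟨fun k ↦ ?_, fun k ↦ ?_⟩, ?_, ?_, ?_⟩
    · have := vk k; simp only [Pi.zero_apply, Pi.sub_apply]; linarith
    · have := vk k; simp only [Pi.one_apply, Pi.sub_apply]; linarith
    · rw [map_sub, vU, hxr, sub_zero]
    · rw [map_sub]; exact hpq.2.2.1
    · rw [map_sub]; exact hpq.2.2.2

/-- A fractional coordinate `i` of a vertex is the only one on its side of `F`, so both side sums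
are non-integral. Hence the bounds `p`, `q` are slack and the other side has a fractional coordinate
too, which permits a perturbation. -/
lemma eq_zero_or_one_of_mem_extremePoints
    (hx : x ∈ (hypersimplexSlice F r p q).extremePoints ℝ) (i : ι) : x i = 0 ∨ x i = 1 := by
  have hxs := extremePoints_subset hx
  obtain ⟨⟨hx0, hx1⟩, hxr, hxp, hxq⟩ := id hxs
  have frac : ∀ j, ¬ (x j = 0 ∨ x j = 1) → 0 < x j ∧ x j < 1 := fun j hj ↦ by
    push Not at hj
    exact ⟨lt_of_le_of_ne (hx0 j) hj.1.symm, lt_of_le_of_ne (hx1 j) hj.2⟩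
  by_contra hi
  set S : Set ι := {j | j ∈ F ↔ i ∈ F} with hS
  have hiS : i ∈ S := Iff.rfl
  have hrest : ∀ j ∈ S \ {i}, x j = 0 ∨ x j = 1 := by
    intro j hj
    by_contra hj'
    exact not_mem_extremePoints_of_fractional hxs (Ne.symm hj.2) (frac i hi) (frac j hj')
      (Or.inl hj.1.symm) hx
  obtain ⟨n, hn⟩ := exists_int_eq_coordSum hrest
  have hSi := coordSum_add_sdiff (singleton_subset_iff.2 hiS) x
  rw [coordSum_apply {i}, finsum_mem_singleton, hn] at hSi
  have nint : ∀ m : ℤ, coordSum S x ≠ m := by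
    intro m hm
    obtain ⟨h0, h1⟩ := frac i hi
    have e : x i = ((m - n : ℤ) : ℝ) := by push_cast; linarith
    rw [e] at h0 h1
    have h0' : 0 < m - n := by exact_mod_cast h0
    have h1' : m - n < 1 := by exact_mod_cast h1
    omega
  have hSc := coordSum_add_sdiff (subset_univ S) x
  have hFc := coordSum_add_sdiff (subset_univ F) x
  rw [hxr] at hSc hFc
  have hSF : coordSum S x = coordSum F x ∨ coordSum S x = r - coordSum F x := by
    by_cases hiF : i ∈ F
    · left
      congr 2
      ext j; simp [hS, hiF]
    · right
      have : S = univ \ F := by ext j; simp [hS, hiF]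
      rw [this]
      linarith
  have nintF : ∀ m : ℤ, coordSum F x ≠ m := by
    intro m hm
    rcases hSF with h | h
    · exact nint m (h.trans hm)
    · exact nint (r - m) (by rw [h, hm]; push_cast; rfl)
  obtain ⟨j, hj, hj'⟩ : ∃ j ∈ univ \ S, ¬ (x j = 0 ∨ x j = 1) := by
    by_contra! hcon
    obtain ⟨m, hm⟩ := exists_int_eq_coordSum (S := univ \ S) (x := x) fun j hj ↦ hcon j hj
    exact nint (r - m) (by push_cast; linarith)
  refine not_mem_extremePoints_of_fractional hxs (i := i) (j := j) ?_ (frac i hi) (frac j hj')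
    (Or.inr ⟨lt_of_le_of_ne hxp ?_, lt_of_le_of_ne hxq ?_⟩) hx
  · rintro rfl
    exact hj.2 hiS
  · exact fun h ↦ nintF p (by rw [← h]; simp)
  · exact fun h ↦ nintF q (by rw [h]; simp)

lemma indicator_mem_Icc (S : Set ι) : S.indicator (1 : ι → ℝ) ∈ Icc 0 1 := by
  classical
  constructor <;> intro i <;> simp only [indicator_apply, Pi.one_apply, Pi.zero_apply] <;>
    split_ifs <;> norm_num

lemma indicator_mem_hypersimplexSlice_iff :
    S.indicator 1 ∈ hypersimplexSlice F r p q ↔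
      S.ncard = r ∧ p ≤ (F ∩ S).ncard ∧ (F ∩ S).ncard ≤ q := by
  simp only [hypersimplexSlice, mem_ofPred_eq, indicator_mem_Icc, true_and, coordSum_indicator,
    univ_inter, Nat.cast_inj, Nat.cast_le]

lemma exists_eq_indicator_of_mem_extremePoints
    (hx : x ∈ (hypersimplexSlice F r p q).extremePoints ℝ) : ∃ S : Set ι, x = S.indicator 1 := by
  classical
  refine ⟨{i | x i = 1}, funext fun i ↦ ?_⟩
  rcases eq_zero_or_one_of_mem_extremePoints hx i with h | h <;> simp [h]

lemma hypersimplexSlice_eq_convexHull (F : Set ι) (r p q : ℕ) :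
    hypersimplexSlice F r p q = convexHull ℝ {x | ∃ S : Set ι,
      (S.ncard = r ∧ p ≤ (F ∩ S).ncard ∧ (F ∩ S).ncard ≤ q) ∧ x = S.indicator 1} := by
  have hsub : (hypersimplexSlice F r p q).extremePoints ℝ ⊆ {x | ∃ S : Set ι,
      (S.ncard = r ∧ p ≤ (F ∩ S).ncard ∧ (F ∩ S).ncard ≤ q) ∧ x = S.indicator 1} := by
    intro x hx
    obtain ⟨S, rfl⟩ := exists_eq_indicator_of_mem_extremePoints hx
    exact ⟨S, indicator_mem_hypersimplexSlice_iff.1 (extremePoints_subset hx), rfl⟩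
  have hfin : {x | ∃ S : Set ι, (S.ncard = r ∧ p ≤ (F ∩ S).ncard ∧ (F ∩ S).ncard ≤ q) ∧
      x = S.indicator (1 : ι → ℝ)}.Finite :=
    (finite_range fun S : Set ι ↦ S.indicator (1 : ι → ℝ)).subset
      fun x ⟨S, _, hS⟩ ↦ ⟨S, hS.symm⟩
  refine Subset.antisymm ?_ (convexHull_min ?_ (convex_hypersimplexSlice F r p q))
  · rw [← convexHull_extremePoints_of_finite (isCompact_hypersimplexSlice F r p q)
      (convex_hypersimplexSlice F r p q) (hfin.subset hsub)]
    exact convexHull_mono hsub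
  · rintro x ⟨S, hS, rfl⟩
    exact indicator_mem_hypersimplexSlice_iff.2 hS

lemma isPolytope_hypersimplexSlice (F : Set ι) (r p q : ℕ) :
    IsPolytope (hypersimplexSlice F r p q) :=
  ⟨_, (finite_range fun S : Set ι ↦ S.indicator (1 : ι → ℝ)).subset (by
    rintro _ ⟨S, _, rfl⟩
    exact ⟨S, rfl⟩), hypersimplexSlice_eq_convexHull F r p q⟩

/-- The bounds `0` and `|F|` are vacuous, so facts about slices apply to the hypersimplex. -/
lemma hypersimplex_eq_slice (F : Set ι) (r : ℕ) :
    hypersimplex ι r = hypersimplexSlice F r 0 F.ncard := by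
  rw [hypersimplexSlice_eq_convexHull, hypersimplex]
  congr 1
  ext x
  refine exists_congr fun S ↦ and_congr_left fun _ ↦ ?_
  rw [← S.toFinite.cast_ncard_eq, Nat.cast_inj]
  simp [ncard_le_ncard (inter_subset_left (s := F) (t := S))]

lemma mem_hypersimplex_iff : x ∈ hypersimplex ι r ↔ x ∈ Icc 0 1 ∧ coordSum univ x = r := by
  rw [hypersimplex_eq_slice ∅]
  simp [hypersimplexSlice]

lemma isPolytope_hypersimplex (r : ℕ) : IsPolytope (hypersimplex ι r) :=
  hypersimplex_eq_slice (∅ : Set ι) r ▸ isPolytope_hypersimplexSlice _ _ _ _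

lemma indicator_mem_extremePoints {A : Set (ι → ℝ)} (hA : A ⊆ Icc 0 1)
    (hS : S.indicator 1 ∈ A) : S.indicator 1 ∈ A.extremePoints ℝ := by
  classical
  refine ⟨hS, fun y hy z hz ⟨s, t, hs, ht, hst, hyz⟩ ↦ funext fun i ↦ ?_⟩
  have h1 := (hA hy).1 i
  have h2 := (hA hy).2 i
  have h3 := (hA hz).1 i
  have h4 := (hA hz).2 i
  have h5 := congrFun hyz i
  simp only [Pi.add_apply, Pi.smul_apply, smul_eq_mul, Pi.zero_apply, Pi.one_apply,
    indicator_apply] at h1 h2 h3 h4 h5 ⊢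
  split_ifs at h5 ⊢ <;> nlinarith

/-- The cells `x(F) ≤ m` and `x(F) ≥ m` have 0-1 vertices, so no new vertices arise. The
inequalities provide vertices with `m - 1`, `m` and `m + 1` ones in `F`: the outer two show that
neither cell contains the other, the middle one that the wall is a nonempty face. -/
lemma isSplitHyperplane_hypersimplex {m : ℕ} (h0 : 0 < m) (h1 : m < F.ncard) (h2 : m < r)
    (h3 : r < m + (univ \ F).ncard) :
    IsSplitHyperplane (hypersimplex ι r)
      (affineSpan ℝ ({x | coordSum F x = m} ∩ hypersimplex ι r)) := by
  have hcap : {x | coordSum F x = m} ∩ hypersimplex ι r =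
      hypersimplexSlice F r 0 m ∩ hypersimplexSlice F r m F.ncard := by
    rw [hypersimplex_eq_slice F]
    ext x
    simp only [hypersimplexSlice, mem_inter_iff, mem_ofPred_eq]
    constructor
    · rintro ⟨e, a, b, c, d⟩
      exact ⟨⟨a, b, c, e.le⟩, a, b, e.ge, d⟩
    · rintro ⟨⟨a, b, c, e⟩, -, -, e', d⟩
      exact ⟨le_antisymm e e', a, b, c, d⟩
  have hle : ∀ x ∈ hypersimplexSlice F r 0 m, coordSum F x ≤ m := fun x hx ↦ hx.2.2.2
  have hge : ∀ x ∈ hypersimplexSlice F r m F.ncard, m ≤ coordSum F x := fun x hx ↦ hx.2.2.1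
  have hsplit : ∀ k : ℕ, k ≤ F.ncard → k ≤ r → r ≤ k + (univ \ F).ncard →
      ∃ S : Set ι, S.ncard = r ∧ (F ∩ S).ncard = k := by
    intro k hk hkr hrk
    obtain ⟨A, hA, hAk⟩ := exists_subset_card_eq hk
    obtain ⟨B, hB, hBk⟩ := exists_subset_card_eq (s := univ \ F) (n := r - k) (by omega)
    refine ⟨A ∪ B, ?_, ?_⟩
    · rw [ncard_union_eq (disjoint_left.2 fun a ha hb ↦ (hB hb).2 (hA ha)), hAk, hBk]
      omega
    · rw [show F ∩ (A ∪ B) = A by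
        ext a
        have := @hA a
        have := @hB a
        simp only [mem_sdiff, mem_univ, true_and] at this
        simp only [mem_inter_iff, mem_union]
        tauto, hAk]
  obtain ⟨S₁, hS₁, hS₁'⟩ := hsplit (m - 1) (by omega) (by omega) (by omega)
  obtain ⟨S₂, hS₂, hS₂'⟩ := hsplit (m + 1) (by omega) (by omega) (by omega)
  obtain ⟨S₃, hS₃, hS₃'⟩ := hsplit m (by omega) (by omega) (by omega)
  have v₁ : S₁.indicator 1 ∈ hypersimplexSlice F r 0 m :=
    indicator_mem_hypersimplexSlice_iff.2 ⟨hS₁, by omega, by omega⟩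
  have v₂ : S₂.indicator 1 ∈ hypersimplexSlice F r m F.ncard :=
    indicator_mem_hypersimplexSlice_iff.2 ⟨hS₂, by omega, by omega⟩
  have v₃ : S₃.indicator 1 ∈ hypersimplexSlice F r 0 m :=
    indicator_mem_hypersimplexSlice_iff.2 ⟨hS₃, by omega, by omega⟩
  have v₃' : S₃.indicator 1 ∈ hypersimplexSlice F r m F.ncard :=
    indicator_mem_hypersimplexSlice_iff.2 ⟨hS₃, by omega, by omega⟩
  have c₁ : coordSum F (S₁.indicator 1) = (m - 1 : ℕ) := by rw [coordSum_indicator, hS₁']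
  have c₂ : coordSum F (S₂.indicator 1) = (m + 1 : ℕ) := by rw [coordSum_indicator, hS₂']
  have c₃ : coordSum F (S₃.indicator 1) = m := by rw [coordSum_indicator, hS₃']
  have hext : ∀ a b : ℕ, (hypersimplexSlice F r a b).extremePoints ℝ ⊆
      (hypersimplex ι r).extremePoints ℝ := by
    intro a b x hx
    obtain ⟨S, rfl⟩ := exists_eq_indicator_of_mem_extremePoints hx
    obtain ⟨h', h'', -⟩ := extremePoints_subset hx
    exact indicator_mem_extremePoints (fun y hy ↦ (mem_hypersimplex_iff.1 hy).1)
      (mem_hypersimplex_iff.2 ⟨h', h''⟩)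
  rw [hcap]
  refine isSplitHyperplane_of_union (isPolytope_hypersimplexSlice _ _ _ _)
    (isPolytope_hypersimplexSlice _ _ _ _) ?_ (fun _ ↦ ⟨coordSum F, ?_⟩)
    (fun _ ↦ ⟨-coordSum F, ?_⟩) (hext _ _) (hext _ _) (fun h ↦ ?_) (fun h ↦ ?_)
  · rw [hypersimplex_eq_slice F]
    ext x
    simp only [hypersimplexSlice, mem_union, mem_ofPred_eq]
    have hm : (m : ℝ) ≤ F.ncard := by exact_mod_cast h1.le
    have hm0 : ((0 : ℕ) : ℝ) ≤ m := by simp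
    constructor
    · rintro (⟨a, b, c, d⟩ | ⟨a, b, c, d⟩)
      · exact ⟨a, b, c, d.trans hm⟩
      · exact ⟨a, b, hm0.trans c, d⟩
    · rintro ⟨a, b, c, d⟩
      rcases le_total (coordSum F x) m with h | h
      · exact Or.inl ⟨a, b, c, h⟩
      · exact Or.inr ⟨a, b, h, d⟩
  · ext x
    refine ⟨fun hx ↦ ⟨hx.1, fun y hy ↦ (hle y hy).trans (hge x hx.2)⟩, fun hx ↦ ⟨hx.1, ?_⟩⟩
    have h4 := hx.2 _ v₃
    rw [c₃] at h4
    obtain ⟨a, b, c, d⟩ := hx.1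
    exact ⟨a, b, h4, d.trans (by exact_mod_cast h1.le)⟩
  · ext x
    refine ⟨fun hx ↦ ⟨hx.2, fun y hy ↦ ?_⟩, fun hx ↦ ⟨?_, hx.1⟩⟩
    · have := hge y hy
      have := hle x hx.1
      simp only [neg_apply]
      linarith
    · have h4 := hx.2 _ v₃'
      simp only [neg_apply, c₃, neg_le_neg_iff] at h4
      obtain ⟨a, b, c, d⟩ := hx.1
      exact ⟨a, b, le_trans (by simp) c, h4⟩
  · have := hge _ (h v₁)
    rw [c₁] at this
    have : m ≤ m - 1 := by exact_mod_cast this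
    omega
  · have := hle _ (h v₂)
    rw [c₂] at this
    have : m + 1 ≤ m := by exact_mod_cast this
    omega

end Hypersimplex

namespace Matroid

variable {α : Type*} {M : Matroid α} {A B C D F G I X Y Z : Set α} {e f : α}

/-! ### Bases adapted to chains, and exchanges -/

lemma exists_isBase_inter_isBasis (hAX : A ⊆ X) (hXD : X ⊆ D) (hD : D ⊆ M.E) :
    ∃ B, M.IsBase B ∧ M.IsBasis (B ∩ A) A ∧ M.IsBasis (B ∩ X) X ∧ M.IsBasis (B ∩ D) D := by
  obtain ⟨I, hI⟩ := M.exists_isBasis A (hAX.trans (hXD.trans hD))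
  obtain ⟨J, hJ, rfl⟩ := hI.exists_isBasis_inter_eq_of_superset hAX (hXD.trans hD)
  obtain ⟨K, hK, rfl⟩ := hJ.exists_isBasis_inter_eq_of_superset hXD hD
  obtain ⟨B, hB, rfl⟩ := hK.exists_isBasis_inter_eq_of_superset hD subset_rfl
  rw [Set.inter_assoc, Set.inter_assoc, Set.inter_eq_right.2 hAX,
    Set.inter_eq_right.2 (hAX.trans hXD)] at hI
  rw [Set.inter_assoc, Set.inter_eq_right.2 hXD] at hJ
  exact ⟨B, isBasis_ground_iff.1 hB, hI, hJ, hK⟩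

lemma exists_isBase_ncard_inter (hAD : A ⊆ D) (hD : D ⊆ M.E) :
    ∃ B, M.IsBase B ∧ (A ∩ B).ncard = M.rk A ∧ (D ∩ B).ncard = M.rk D := by
  obtain ⟨B, hB, hA, -, hBD⟩ := exists_isBase_inter_isBasis hAD subset_rfl hD
  exact ⟨B, hB, by rw [Set.inter_comm, hA.ncard_eq_rk], by rw [Set.inter_comm, hBD.ncard_eq_rk]⟩

/-- If a set does not separate the minor between `A` and `D`, then some exchange between bases
adapted to `A` and `D` crosses it. -/
lemma exists_isBase_exchange [M.Finite] (hAX : A ⊆ X) (hXD : X ⊆ D) (hD : D ⊆ M.E)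
    (h : M.rk A + M.rk D < M.rk X + M.rk (A ∪ (D \ X))) :
    ∃ B, ∃ e ∈ X \ A, ∃ f ∈ D \ X, e ∈ B ∧ f ∉ B ∧ M.IsBase B ∧ M.IsBase (insert f B \ {e}) ∧
      ((A ∩ B).ncard = M.rk A ∧ (D ∩ B).ncard = M.rk D) ∧
      ((A ∩ (insert f B \ {e})).ncard = M.rk A ∧ (D ∩ (insert f B \ {e})).ncard = M.rk D) := by
  obtain ⟨B, hB, hBA, hBX, hBD⟩ := exists_isBase_inter_isBasis hAX hXD hD
  have hfin : ∀ S ⊆ D, (B ∩ S).Finite := fun S hS ↦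
    M.ground_finite.subset (Set.inter_subset_right.trans (hS.trans hD))
  set Y := A ∪ (D \ X) with hY
  have hYD : Y ⊆ D := Set.union_subset (hAX.trans hXD) Set.sdiff_subset
  -- If `B` were also adapted to `Y`, counting `B` on `X` and `Y` would give equality in `h`.
  have hYcl : ¬ Y ⊆ M.closure (B ∩ Y) := by
    intro hcl
    have hbas : M.IsBasis (B ∩ Y) Y :=
      (hB.indep.subset Set.inter_subset_left).isBasis_of_subset_of_subset_closure
      Set.inter_subset_right hcl
    have h1 := Set.ncard_union_add_ncard_inter (B ∩ X) (B ∩ Y) (hfin X hXD) (hfin Y hYD)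
    rw [show B ∩ X ∪ B ∩ Y = B ∩ D by grind, show B ∩ X ∩ (B ∩ Y) = B ∩ A by grind,
      hBA.ncard_eq_rk, hBX.ncard_eq_rk, hBD.ncard_eq_rk, hbas.ncard_eq_rk] at h1
    omega
  obtain ⟨f, hfY, hfcl⟩ := Set.not_subset.1 hYcl
  have hfA : f ∉ A := fun hfA ↦
    hfcl (M.closure_subset_closure (by grind) (hBA.subset_closure hfA))
  have hfD : f ∈ D \ X := hfY.resolve_left hfA
  have hfB : f ∉ B := fun hfB ↦ hfcl (M.mem_closure_of_mem' ⟨hfB, hfY⟩ (hD hfD.1))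
  have hI : M.Indep (B ∩ D) := hBD.indep
  have hfI : f ∉ B ∩ D := fun h ↦ hfB h.1
  have hC := hI.fundCircuit_isCircuit (hBD.subset_closure hfD.1) hfI
  have hCI := M.fundCircuit_subset_insert f (B ∩ D)
  have hCB := hC.eq_fundCircuit_of_subset hB.indep
    (hCI.trans (Set.insert_subset_insert Set.inter_subset_left))
  -- A fundamental circuit inside `insert f (B ∩ Y)` would put `f` in the closure of `B ∩ Y`.
  obtain ⟨e, heC, he⟩ : ∃ e ∈ M.fundCircuit f (B ∩ D), e ∉ insert f (B ∩ Y) := by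
    refine Set.not_subset.1 fun hsub ↦ hfcl ?_
    have h1 := hC.mem_closure_sdiff_singleton_of_mem (M.mem_fundCircuit f (B ∩ D))
    exact M.closure_subset_closure (by grind) h1
  have heI : e ∈ B ∩ D := by
    rcases hCI heC with rfl | h
    · exact absurd (Set.mem_insert _ _) he
    · exact h
  have heXA : e ∈ X \ A := by grind
  have hexch : M.Indep (insert f B \ {e}) :=
    (hB.indep.mem_fundCircuit_iff (by rw [hB.closure_eq]; exact hD hfD.1) hfB).1 (hCB ▸ heC)
  refine ⟨B, e, heXA, f, hfD, heI.1, hfB, hB, hB.exchange_isBase_of_indep' heI.1 hfB hexch,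
    ⟨?_, ?_⟩, ?_, ?_⟩
  · rw [Set.inter_comm, hBA.ncard_eq_rk]
  · rw [Set.inter_comm, hBD.ncard_eq_rk]
  · rw [show A ∩ (insert f B \ {e}) = B ∩ A by grind, hBA.ncard_eq_rk]
  · rw [show D ∩ (insert f B \ {e}) = insert f (B ∩ D) \ {e} by grind,
      Set.ncard_exchange' hfI heI, hBD.ncard_eq_rk]

/-- Apply the hypothesis to a base adapted to `Y \ F ⊆ Y`. This turns containments between faces of
the polytope into separations. -/
lemma rk_add_rk_sdiff_le_of_forall_isBase [M.Finite] (hFY : F ⊆ Y) (hY : Y ⊆ M.E)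
    (h : ∀ B, M.IsBase B → (Y ∩ B).ncard = M.rk Y → (F ∩ B).ncard = M.rk F) :
    M.rk F + M.rk (Y \ F) ≤ M.rk Y := by
  obtain ⟨B, hB, h1, h2⟩ := exists_isBase_ncard_inter (Set.sdiff_subset (s := Y) (t := F)) hY
  have h3 := h B hB h2
  have h4 := Set.ncard_union_eq (s := F ∩ B) (t := (Y \ F) ∩ B)
    (Set.disjoint_left.2 fun a ha hb ↦ hb.1.2 ha.1)
    (M.ground_finite.subset (Set.inter_subset_left.trans (hFY.trans hY)))
    (M.ground_finite.subset (Set.inter_subset_left.trans (Set.sdiff_subset.trans hY)))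
  rw [← Set.union_inter_distrib_right, Set.union_sdiff_cancel hFY] at h4
  omega

/-! ### The matroid polytope -/

/-- The characteristic vector of a set, as a vector indexed by the ground set. -/
noncomputable def charVec (M : Matroid α) (B : Set α) : M.E → ℝ :=
  Set.indicator {i : M.E | (i : α) ∈ B} 1

lemma groundSum_charVec [M.Finite] (hF : F ⊆ M.E) (B : Set α) :
    M.groundSum F (M.charVec B) = (F ∩ B).ncard := by
  rw [groundSum, charVec, coordSum_indicator,
    ← ncard_preimage_ground (Set.inter_subset_left.trans hF)]
  rfl

lemma charVec_mem_polytope (hB : M.IsBase B) : M.charVec B ∈ M.polytope :=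
  subset_convexHull ℝ _ ⟨B, hB, rfl⟩

lemma apply_le_of_mem_polytope [M.Finite] (l : (M.E → ℝ) →L[ℝ] ℝ) {b : ℝ}
    (h : ∀ B, M.IsBase B → l (M.charVec B) ≤ b) {x : M.E → ℝ} (hx : x ∈ M.polytope) :
    l x ≤ b := by
  refine le_of_mem_convexHull l ?_ hx
  rintro _ ⟨B, hB, rfl⟩
  exact h B hB

lemma apply_eq_of_mem_polytope [M.Finite] (l : (M.E → ℝ) →L[ℝ] ℝ) {b : ℝ}
    (h : ∀ B, M.IsBase B → l (M.charVec B) = b) {x : M.E → ℝ} (hx : x ∈ M.polytope) :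
    l x = b := by
  refine eq_of_mem_convexHull l ?_ hx
  rintro _ ⟨B, hB, rfl⟩
  exact h B hB

lemma groundSum_ground_charVec [M.Finite] (hB : M.IsBase B) :
    M.groundSum M.E (M.charVec B) = M.rk M.E := by
  rw [groundSum_charVec subset_rfl, Set.inter_eq_right.2 hB.subset_ground, hB.ncard_eq_rk]

lemma groundSum_ground_of_mem_polytope [M.Finite] {x : M.E → ℝ} (hx : x ∈ M.polytope) :
    M.groundSum M.E x = M.rk M.E :=
  apply_eq_of_mem_polytope _ (fun _ hB ↦ groundSum_ground_charVec hB) hx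

lemma groundSum_le_rk_of_mem_polytope [M.Finite] (hF : F ⊆ M.E) {x : M.E → ℝ}
    (hx : x ∈ M.polytope) : M.groundSum F x ≤ M.rk F := by
  refine apply_le_of_mem_polytope _ (fun B hB ↦ ?_) hx
  rw [groundSum_charVec hF, Nat.cast_le]
  exact (hB.indep.inter_left F).ncard_le_rk Set.inter_subset_left

lemma mem_Icc_of_mem_polytope [M.Finite] {x : M.E → ℝ} (hx : x ∈ M.polytope) :
    x ∈ Set.Icc (0 : M.E → ℝ) 1 := by
  refine convexHull_min ?_ (convex_Icc _ _) hx
  rintro _ ⟨B, -, rfl⟩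
  exact indicator_mem_Icc _

/-- The face of the matroid polytope on which the sum over `F` is maximal. -/
def rankFace (M : Matroid α) (F : Set α) : Set (M.E → ℝ) := M.flatHyperplane F ∩ M.polytope

lemma mem_rankFace_iff [M.Finite] {x : M.E → ℝ} :
    x ∈ M.rankFace F ↔ M.groundSum F x = M.rk F ∧ x ∈ M.polytope := Iff.rfl

lemma charVec_mem_rankFace_iff [M.Finite] (hF : F ⊆ M.E) (hB : M.IsBase B) :
    M.charVec B ∈ M.rankFace F ↔ (F ∩ B).ncard = M.rk F := by
  rw [mem_rankFace_iff, groundSum_charVec hF, Nat.cast_inj,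
    and_iff_left (charVec_mem_polytope hB)]

lemma isExposed_rankFace [M.Finite] (hF : F ⊆ M.E) : IsExposed ℝ M.polytope (M.rankFace F) := by
  refine fun _ ↦ ⟨M.groundSum F, Set.ext fun x ↦
    ⟨fun hx ↦ ⟨hx.2, fun y hy ↦ ?_⟩, fun hx ↦ ⟨?_, hx.1⟩⟩⟩
  · rw [(mem_rankFace_iff.1 hx).1]
    exact groundSum_le_rk_of_mem_polytope hF hy
  · obtain ⟨B, hB, hFB, -⟩ := exists_isBase_ncard_inter (subset_refl F) hF
    have h := hx.2 _ (charVec_mem_polytope hB)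
    rw [groundSum_charVec hF, hFB] at h
    exact le_antisymm (groundSum_le_rk_of_mem_polytope hF hx.1) h

lemma rankFace_ne_polytope [M.Finite] (hM : M.ConnBetween ∅ M.E) (hF : F ⊂ M.E)
    (hne : F.Nonempty) : M.rankFace F ≠ M.polytope := by
  intro h
  refine (hM.rk_lt_add hF hne).not_ge
    (rk_add_rk_sdiff_le_of_forall_isBase hF.subset subset_rfl fun B hB _ ↦ ?_)
  rw [← charVec_mem_rankFace_iff hF.subset hB, h]
  exact charVec_mem_polytope hB

lemma rankFace_ground [M.Finite] : M.rankFace M.E = M.polytope :=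
  Set.inter_eq_right.2 fun _ hx ↦ groundSum_ground_of_mem_polytope hx

lemma rankFace_eq_of_subset [M.Finite] (hfac : IsFacetOf M.polytope (M.rankFace F))
    (hM : M.ConnBetween ∅ M.E) (hG : G ⊂ M.E) (hne : G.Nonempty)
    (h : M.rankFace F ⊆ M.rankFace G) : M.rankFace F = M.rankFace G := by
  by_contra hcon
  exact rankFace_ne_polytope hM hG hne
    (hfac.2.2 _ (isExposed_rankFace hG.subset) (h.ssubset_of_ne hcon))

/-! ### Functionals that are constant on bases -/

/-- The coefficient of a functional at a ground element. -/
noncomputable def coeff (M : Matroid α) (l : (M.E → ℝ) →L[ℝ] ℝ) (i : M.E) : ℝ :=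
  l (Set.indicator {i} 1)

lemma apply_eq_groundSum_coeff [M.Finite] (l : (M.E → ℝ) →L[ℝ] ℝ) (x : M.E → ℝ) :
    l x = M.groundSum M.E (fun i ↦ M.coeff l i * x i) := by
  classical
  have := Fintype.ofFinite M.E
  have h1 : x = ∑ i, x i • Set.indicator {i} (1 : M.E → ℝ) := by
    ext j
    simp [Finset.sum_apply, Pi.single_apply]
  have h2 : M.groundSum M.E (fun i ↦ M.coeff l i * x i) = ∑ i, M.coeff l i * x i := by
    rw [groundSum, coordSum_apply, Subtype.coe_preimage_self, finsum_mem_univ,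
      finsum_eq_sum_of_fintype]
  rw [h2]
  conv_lhs => rw [h1]
  rw [map_sum]
  refine Finset.sum_congr rfl fun i _ ↦ ?_
  rw [map_smul, smul_eq_mul, mul_comm, coeff]

lemma charVec_exchange (he : e ∈ M.E) (hf : f ∈ M.E) (heB : e ∈ B) (hfB : f ∉ B) :
    M.charVec (insert f B \ {e}) =
      M.charVec B + Set.indicator {⟨f, hf⟩} 1 - Set.indicator {⟨e, he⟩} 1 := by
  classical
  have hfe : f ≠ e := fun h ↦ hfB (h ▸ heB)
  ext ⟨i, hi⟩
  simp only [charVec, Set.indicator_apply, Set.mem_ofPred_eq, Pi.sub_apply, Pi.add_apply,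
    Subtype.mk.injEq, Set.mem_sdiff, Set.mem_insert_iff, Set.mem_singleton_iff,
    Pi.one_apply]
  by_cases h1 : i = e
  · subst h1
    simp [heB, hfe.symm]
  · by_cases h2 : i = f
    · subst h2
      simp [hfB, h1]
    · simp [h1, h2]

lemma ConnBetween.coeff_eq [M.Finite] (h : M.ConnBetween A D) (hAD : A ⊆ D) (hD : D ⊆ M.E)
    (l : (M.E → ℝ) →L[ℝ] ℝ) {b : ℝ}
    (hl : ∀ B, M.IsBase B → (A ∩ B).ncard = M.rk A → (D ∩ B).ncard = M.rk D →
      l (M.charVec B) = b) {i j : M.E} (hi : (i : α) ∈ D \ A) (hj : (j : α) ∈ D \ A) :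
    M.coeff l i = M.coeff l j := by
  classical
  by_contra hne
  -- A level set of the coefficients. An exchange of adapted bases across it forces equal
  -- coefficients at `e` and `f`, a contradiction.
  set X : Set α := A ∪ {a | a ∈ D \ A ∧ ∃ ha : a ∈ M.E, M.coeff l ⟨a, ha⟩ = M.coeff l i} with hX
  have hiX : (i : α) ∈ X := Or.inr ⟨hi, i.2, rfl⟩
  have hjX : (j : α) ∉ X := by
    rintro (h | ⟨-, _, h⟩)
    · exact hj.2 h
    · exact hne h.symm
  have hAX : A ⊂ X := Set.ssubset_iff_exists.2 ⟨Set.subset_union_left, i, hiX, hi.2⟩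
  have hXD : X ⊂ D := by
    refine Set.ssubset_iff_exists.2 ⟨Set.union_subset hAD fun a ha ↦ ha.1.1, j, hj.1, hjX⟩
  obtain ⟨B, e, he, f, hf, heB, hfB, hB, hB', ⟨c1, c2⟩, c3, c4⟩ :=
    exists_isBase_exchange hAX.subset hXD.subset hD (h X hAX hXD)
  have heE : e ∈ M.E := hD (hXD.subset he.1)
  have hfE : f ∈ M.E := hD hf.1
  have h1 := hl B hB c1 c2
  have h2 := hl _ hB' c3 c4
  rw [charVec_exchange heE hfE heB hfB, map_sub, map_add, h1] at h2
  obtain ⟨-, _, h3⟩ := he.1.resolve_left he.2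
  have h4 : M.coeff l ⟨f, hfE⟩ = M.coeff l ⟨e, heE⟩ := by
    simp only [coeff]
    linarith
  exact hf.2 (Or.inr ⟨⟨hf.1, fun hfA ↦ hf.2 (Or.inl hfA)⟩, hfE, h4.trans h3⟩)

lemma exists_coeff_eq [M.Finite] (h : M.ConnBetween A D) (hAD : A ⊆ D) (hD : D ⊆ M.E)
    (l : (M.E → ℝ) →L[ℝ] ℝ) {b : ℝ}
    (hl : ∀ B, M.IsBase B → (A ∩ B).ncard = M.rk A → (D ∩ B).ncard = M.rk D →
      l (M.charVec B) = b) :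
    ∃ a, ∀ x : M.E → ℝ, M.groundSum (D \ A) (fun i ↦ M.coeff l i * x i) =
      a * M.groundSum (D \ A) x := by
  obtain ⟨a, ha⟩ : ∃ a, ∀ i : M.E, (i : α) ∈ D \ A → M.coeff l i = a := by
    by_cases hne : ∃ i : M.E, (i : α) ∈ D \ A
    · obtain ⟨i, hi⟩ := hne
      exact ⟨M.coeff l i, fun j hj ↦ h.coeff_eq hAD hD l hl hj hi⟩
    · exact ⟨0, fun i hi ↦ absurd ⟨i, hi⟩ hne⟩
  refine ⟨a, fun x ↦ ?_⟩
  rw [← smul_eq_mul, ← map_smul]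
  refine coordSum_congr fun i hi ↦ ?_
  rw [ha i hi]
  rfl

/-! ### The affine span and the relative interior -/

/-- By connectivity, a functional constant on all bases is a multiple of the total sum, so no
further equation holds on the span. -/
lemma mem_affineSpan_polytope_iff [M.Finite] (hM : M.ConnBetween ∅ M.E) {x : M.E → ℝ} :
    x ∈ affineSpan ℝ M.polytope ↔ M.groundSum M.E x = M.rk M.E := by
  constructor
  · intro hx
    refine affineSpan_induction (p := fun y ↦ M.groundSum M.E y = M.rk M.E) hx
      (fun y hy ↦ groundSum_ground_of_mem_polytope hy) fun c u v w hu hv hw ↦ ?_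
    simp [hu, hv, hw]
  · intro hx
    obtain ⟨B₀, hB₀⟩ := M.exists_isBase
    have h0 : M.charVec B₀ ∈ affineSpan ℝ M.polytope :=
      subset_affineSpan ℝ _ (charVec_mem_polytope hB₀)
    by_contra hcon
    rw [← AffineSubspace.vsub_right_mem_direction_iff_mem h0, vsub_eq_sub] at hcon
    obtain ⟨g, hg, hker⟩ := Submodule.exists_le_ker_of_notMem hcon
    set l : (M.E → ℝ) →L[ℝ] ℝ := LinearMap.toContinuousLinearMap g with hl
    have hconst : ∀ B, M.IsBase B → l (M.charVec B) = l (M.charVec B₀) := by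
      intro B hB
      have h1 := hker (AffineSubspace.vsub_mem_direction
        (subset_affineSpan ℝ _ (charVec_mem_polytope hB)) h0)
      rw [LinearMap.mem_ker, vsub_eq_sub, map_sub] at h1
      exact sub_eq_zero.1 h1
    obtain ⟨a, ha⟩ := exists_coeff_eq hM (Set.empty_subset _) subset_rfl l
      fun B hB _ _ ↦ hconst B hB
    rw [Set.sdiff_empty] at ha
    refine hg ?_
    change l (x - M.charVec B₀) = 0
    rw [apply_eq_groundSum_coeff, ha, map_sub, hx, groundSum_ground_charVec hB₀, sub_self, mul_zero]

lemma mem_intrinsicInterior_iff [M.Finite] (hM : M.ConnBetween ∅ M.E) (h0 : 0 < M.rk M.E)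
    (h1 : M.rk M.E < M.E.ncard) {x : M.E → ℝ} :
    x ∈ intrinsicInterior ℝ
        ((affineSpan ℝ M.polytope : Set (M.E → ℝ)) ∩ Set.Icc (0 : M.E → ℝ) 1) ↔
      (∀ i, 0 < x i ∧ x i < 1) ∧ M.groundSum M.E x = M.rk M.E := by
  have h0' : (0 : ℝ) < M.rk M.E := by exact_mod_cast h0
  have h1' : (M.rk M.E : ℝ) < M.E.ncard := by exact_mod_cast h1
  constructor
  · intro hx
    have hxs := intrinsicInterior_subset hx
    refine ⟨fun i ↦ ?_, (mem_affineSpan_polytope_iff hM).1 hxs.1⟩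
    -- The constant vector `t` lies in the slice strictly inside the cube; pushing `x` away from it
    -- would leave the cube if some `x i` were 0 or 1.
    set t : ℝ := M.rk M.E / M.E.ncard with ht
    have ht0 : 0 < t := div_pos h0' (h0'.trans h1')
    have ht1 : t < 1 := (div_lt_one (h0'.trans h1')).2 h1'
    obtain ⟨ε, hε, hmem⟩ := exists_add_smul_sub_mem_of_mem_intrinsicInterior
      (c := fun _ ↦ t) hx ⟨(mem_affineSpan_polytope_iff hM).2 (by
        rw [groundSum, coordSum_const, ncard_preimage_ground subset_rfl,
          mul_div_cancel₀ _ (h0'.trans h1').ne']), fun _ ↦ ht0.le, fun _ ↦ ht1.le⟩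
    have a1 := hmem.2.1 i
    have a2 := hmem.2.2 i
    have a3 := hxs.2.1 i
    have a4 := hxs.2.2 i
    simp only [Pi.zero_apply, Pi.one_apply, Pi.add_apply, Pi.smul_apply, Pi.sub_apply,
      smul_eq_mul] at a1 a2 a3 a4
    constructor
    · by_contra! hcon
      nlinarith
    · by_contra! hcon
      nlinarith
  · rintro ⟨hx, hxE⟩
    refine mem_intrinsicInterior_inter (U := Set.univ.pi fun _ ↦ Set.Ioo 0 1)
      (isOpen_set_pi Set.finite_univ fun _ _ ↦ isOpen_Ioo) ?_
      ((mem_affineSpan_polytope_iff hM).2 hxE) fun i _ ↦ hx i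
    exact fun y hy ↦ ⟨fun i ↦ (hy i trivial).1.le, fun i ↦ (hy i trivial).2.le⟩

/-! ### Split flacets are split sets -/

lemma IsFlacet.rk_pos [M.Finite] (h : M.IsFlacet F) : 0 < M.rk F := by
  rw [Nat.pos_iff_ne_zero]
  intro h0
  refine h.2.1.2.1 (Set.inter_eq_right.2 fun x hx ↦ ?_)
  have h1 := groundSum_le_rk_of_mem_polytope h.1.subset_ground hx
  have h2 : 0 ≤ M.groundSum F x := coordSum_nonneg fun i _ ↦ (mem_Icc_of_mem_polytope hx).1 i
  rw [mem_flatHyperplane_iff]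
  rw [h0] at h1 ⊢
  exact le_antisymm h1 (by simpa using h2)

lemma IsFlacet.ssubset_ground [M.Finite] (h : M.IsFlacet F) : F ⊂ M.E := by
  refine h.1.subset_ground.ssubset_of_ne ?_
  rintro rfl
  exact h.2.1.2.1 rankFace_ground

lemma IsFlacet.nonempty [M.Finite] (h : M.IsFlacet F) : F.Nonempty := by
  rw [Set.nonempty_iff_ne_empty]
  rintro rfl
  simpa using h.rk_pos

/-- If `X` separates `M|F`, the closure of `X` defines the same facet, so it equals `F` by
minimality. Then `F \ X` has rank zero, but `M` has no loops. -/
lemma IsFlacet.connBetween_empty [M.Finite] (hM : M.ConnBetween ∅ M.E) (h : M.IsFlacet F) :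
    M.ConnBetween ∅ F := by
  have hFE := h.1.subset_ground
  rw [connBetween_empty_iff]
  intro X hX hne
  by_contra! hcon
  have hXE := hX.subset.trans hFE
  have hGF : M.closure X ⊆ F := h.1.closure ▸ M.closure_subset_closure hX.subset
  have hXG := M.subset_closure X hXE
  have hcon' : (M.rk X : ℝ) + M.rk (F \ X) ≤ M.rk F := by exact_mod_cast hcon
  have hsub : M.rankFace F ⊆ M.rankFace (M.closure X) := by
    rintro x ⟨hxF, hx⟩
    rw [mem_flatHyperplane_iff] at hxF
    have h1 := groundSum_le_rk_of_mem_polytope (Set.sdiff_subset.trans hFE : F \ X ⊆ M.E) hx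
    have h2 := groundSum_le_rk_of_mem_polytope (M.closure_subset_ground X) hx
    have h3 := groundSum_add_sdiff hX.subset x
    have h4 := groundSum_add_sdiff hXG x
    have h5 : 0 ≤ M.groundSum (M.closure X \ X) x :=
      coordSum_nonneg fun i _ ↦ (mem_Icc_of_mem_polytope hx).1 i
    refine ⟨?_, hx⟩
    rw [mem_flatHyperplane_iff]
    rw [M.rk_closure] at h2 ⊢
    linarith
  have heq := rankFace_eq_of_subset h.2.1 hM (hGF.trans_ssubset h.ssubset_ground)
    (hne.mono hXG) hsub
  have hcl := h.2.2 _ (M.isFlat_closure X) hGF heq.symm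
  have hk := M.rk_closure X
  rw [hcl] at hk
  have hpos := hM.rk_pos (h.rk_pos.trans_le (M.rk_mono hFE))
    (Set.sdiff_subset.trans hFE : F \ X ⊆ M.E) (Set.sdiff_nonempty.2 hX.not_subset)
  omega

/-- If `Y` separates `M/F`, the opposite side `Y'` defines the same facet as `F`. Hence `F`
separates `M|Y'`, and adding the two rank inequalities makes `Y` separate `M`. -/
lemma IsFlacet.connBetween_ground [M.Finite] (hM : M.ConnBetween ∅ M.E) (h : M.IsFlacet F) :
    M.ConnBetween F M.E := by
  have hFE := h.1.subset_ground
  have hFne := h.nonempty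
  intro Y hFY hYE
  by_contra! hcon
  set Y' := F ∪ (M.E \ Y) with hY'
  have hY'E : Y' ⊆ M.E := Set.union_subset hFE Set.sdiff_subset
  have hY'ss : Y' ⊂ M.E := by
    obtain ⟨a, haY, haF⟩ := Set.exists_of_ssubset hFY
    exact Set.ssubset_iff_exists.2 ⟨hY'E, a, hYE.subset haY, by grind⟩
  have hcon' : (M.rk Y : ℝ) + M.rk Y' ≤ M.rk F + M.rk M.E := by exact_mod_cast hcon
  have hsum : ∀ x ∈ M.rankFace F, M.groundSum Y x = M.rk Y ∧ M.groundSum Y' x = M.rk Y' := by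
    rintro x ⟨hxF, hx⟩
    rw [mem_flatHyperplane_iff] at hxF
    have h1 := groundSum_le_rk_of_mem_polytope hYE.subset hx
    have h2 := groundSum_le_rk_of_mem_polytope hY'E hx
    have h3 := groundSum_union_add_inter Y Y' x
    rw [show Y ∪ Y' = M.E by grind, show Y ∩ Y' = F by grind,
      groundSum_ground_of_mem_polytope hx] at h3
    constructor <;> linarith
  have e1 := rankFace_eq_of_subset h.2.1 hM hYE (hFne.mono hFY.subset)
    fun x hx ↦ ⟨(hsum x hx).1, hx.2⟩
  have e2 := rankFace_eq_of_subset h.2.1 hM hY'ss (hFne.mono Set.subset_union_left)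
    fun x hx ↦ ⟨(hsum x hx).2, hx.2⟩
  have key : ∀ S, F ⊆ S → S ⊆ M.E → M.rankFace F = M.rankFace S →
      M.rk F + M.rk (S \ F) ≤ M.rk S := by
    intro S hFS hSE heq
    refine rk_add_rk_sdiff_le_of_forall_isBase hFS hSE fun B hB hSB ↦ ?_
    rwa [← charVec_mem_rankFace_iff hFE hB, heq, charVec_mem_rankFace_iff hSE hB]
  have k2 := key Y' Set.subset_union_left hY'E e2
  rw [show Y' \ F = M.E \ Y by grind] at k2
  have k3 := hM.rk_lt_add hYE (hFne.mono hFY.subset)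
  omega

lemma rk_ground_eq (M : Matroid α) : M.rk M.E = M.eRank.toNat := by
  rw [rk, eRk_ground]

lemma groundSum_ground [M.Finite] (x : M.E → ℝ) : M.groundSum M.E x = coordSum Set.univ x := by
  rw [groundSum, Subtype.coe_preimage_self]

/-- What remains is `r(F) < |F|`. Otherwise `x(F) ≤ r(F)` on the whole hypersimplex, whereas a split
hyperplane has points of it on both sides. -/
lemma IsSplitFlacet.isSplitSet [M.Finite] (hM : M.ConnBetween ∅ M.E) (h : M.IsSplitFlacet F) :
    M.IsSplitSet F := by
  obtain ⟨hF, hsp⟩ := h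
  have hFE := hF.1.subset_ground
  refine .of_connBetween hM hFE (hF.connBetween_empty hM) (hF.connBetween_ground hM) hF.rk_pos ?_
    (hF.1.rk_lt_rk subset_rfl hF.ssubset_ground)
  by_contra! hcon
  have h1 := hM.rk_lt_add hF.ssubset_ground hF.nonempty
  have h2 := M.rk_le_ncard hFE
  have h3 := M.rk_le_ncard (X := M.E \ F) Set.sdiff_subset
  have h4 := Set.ncard_sdiff_add_ncard_of_subset hFE M.ground_finite
  have h5 : (M.rk M.E : ℝ) < M.E.ncard := by exact_mod_cast (by omega : M.rk M.E < M.E.ncard)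
  have h6 : (0 : ℝ) < M.E.ncard := (Nat.cast_nonneg _).trans_lt h5
  have h7 : (0 : ℝ) < F.ncard := by exact_mod_cast hF.rk_pos.trans_le h2
  have hFr : (F.ncard : ℝ) ≤ M.rk F := by exact_mod_cast hcon
  set t : ℝ := M.rk M.E / M.E.ncard with ht
  have ht0 : 0 ≤ t := by positivity
  have ht1 : t < 1 := (div_lt_one h6).2 h5
  have hle : affineSpan ℝ (M.flatHyperplane F ∩ hypersimplex M.E M.eRank.toNat) ≤
      affineSpan ℝ (M.flatHyperplane F) := affineSpan_mono ℝ Set.inter_subset_left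
  obtain ⟨y, hy, hyF⟩ := hsp.exists_lt (isPolytope_hypersimplex _) (M.groundSum F)
    (b := M.rk F) (x := fun _ ↦ t)
    (fun x hx ↦ affineSpan_induction (p := fun y ↦ M.groundSum F y = M.rk F) (hle hx)
      (fun y hy ↦ hy) fun c u v w hu hv hw ↦ by simp [hu, hv, hw])
    (mem_hypersimplex_iff.2 ⟨⟨fun _ ↦ ht0, fun _ ↦ ht1.le⟩, by
      rw [← groundSum_ground, groundSum, coordSum_const, ncard_preimage_ground subset_rfl,
        mul_div_cancel₀ _ h6.ne', rk_ground_eq]⟩)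
    (by
      rw [groundSum, coordSum_const, ncard_preimage_ground hFE]
      nlinarith)
  have h8 : M.groundSum F y ≤ F.ncard := by
    rw [← ncard_preimage_ground hFE]
    exact coordSum_le_ncard fun i _ ↦ (mem_hypersimplex_iff.1 hy).1.2 i
  linarith

/-! ### Split sets are split flacets -/

lemma IsSplitSet.ssubset_ground (h : M.IsSplitSet F) : F ⊂ M.E :=
  h.subset_ground.ssubset_of_ne fun heq ↦ by
    have := h.rk_lt_rk
    rw [heq] at this
    omega

lemma IsSplitSet.nonempty (h : M.IsSplitSet F) : F.Nonempty := by
  rw [Set.nonempty_iff_ne_empty]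
  rintro rfl
  simpa using h.rk_pos

/-- Connectivity of `M|F` and `M/F` gives the exposing functional a constant coefficient `a` on `F`
and `b` off `F`. A point of `Q` off the hyperplane of `F` forces `a = b`, so the functional is
constant on the polytope. -/
lemma IsSplitSet.eq_polytope_of_rankFace_ssubset [M.Finite] (h : M.IsSplitSet F)
    {Q : Set (M.E → ℝ)} (hQ : IsExposed ℝ M.polytope Q) (hFQ : M.rankFace F ⊂ Q) :
    Q = M.polytope := by
  have hFE := h.subset_ground
  obtain ⟨z, hzQ, hzF⟩ := Set.exists_of_ssubset hFQ
  obtain ⟨l, hl⟩ := hQ ⟨z, hzQ⟩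
  obtain ⟨B₀, hB₀, hFB₀, -⟩ := exists_isBase_ncard_inter (subset_refl F) hFE
  have memQ : ∀ y, y ∈ Q ↔ y ∈ M.polytope ∧ ∀ w ∈ M.polytope, l w ≤ l y := fun y ↦ by
    rw [hl]; rfl
  have hzP := hQ.subset hzQ
  have eqQ : ∀ y ∈ Q, l y = l z := fun y hy ↦
    le_antisymm (((memQ z).1 hzQ).2 y (hQ.subset hy)) (((memQ y).1 hy).2 z hzP)
  have hbase : ∀ B, M.IsBase B → (F ∩ B).ncard = M.rk F → l (M.charVec B) = l z :=
    fun B hB hFB ↦ eqQ _ (hFQ.subset ((charVec_mem_rankFace_iff hFE hB).2 hFB))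
  obtain ⟨a, ha⟩ := exists_coeff_eq h.conn_restrict (Set.empty_subset _) hFE l
    fun B hB _ hFB ↦ hbase B hB hFB
  obtain ⟨b, hb⟩ := exists_coeff_eq h.conn_contract hFE subset_rfl l
    fun B hB hFB _ ↦ hbase B hB hFB
  rw [Set.sdiff_empty] at ha
  have hlx : ∀ x ∈ M.polytope, l x = (a - b) * M.groundSum F x + b * M.rk M.E := by
    intro x hx
    have h1 := groundSum_add_sdiff hFE x
    rw [groundSum_ground_of_mem_polytope hx] at h1
    rw [apply_eq_groundSum_coeff, ← groundSum_add_sdiff hFE, ha, hb, ← h1]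
    ring
  have hv₀ := charVec_mem_polytope hB₀
  have e1 := hbase B₀ hB₀ hFB₀
  rw [hlx _ hv₀, hlx z hzP, groundSum_charVec hFE, hFB₀] at e1
  have hz : M.groundSum F z ≠ M.rk F := fun hz ↦ hzF ⟨hz, hzP⟩
  have hab : a - b = 0 := by
    by_contra hne
    exact hz (mul_left_cancel₀ hne (by linarith)).symm
  refine Set.Subset.antisymm hQ.subset fun x hx ↦ (memQ x).2 ⟨hx, fun w hw ↦ ?_⟩
  rw [hlx x hx, hlx w hw, hab, zero_mul, zero_mul]

lemma IsSplitSet.isFlacet [M.Finite] (hM : M.ConnBetween ∅ M.E) (h : M.IsSplitSet F) :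
    M.IsFlacet F := by
  have hFE := h.subset_ground
  have hne := rankFace_ne_polytope hM h.ssubset_ground h.nonempty
  refine ⟨h.isFlat, ⟨isExposed_rankFace hFE, hne,
    fun Q hQ hFQ ↦ h.eq_polytope_of_rankFace_ssubset hQ hFQ⟩, fun G hG hGF heq ↦ ?_⟩
  by_contra hGne
  rcases G.eq_empty_or_nonempty with rfl | hGn
  · refine hne (heq.symm.trans (Set.inter_eq_right.2 fun x _ ↦ ?_))
    simp [mem_flatHyperplane_iff, groundSum]
  · refine (h.conn_restrict.rk_lt_add (hGF.ssubset_of_ne hGne) hGn).not_ge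
      (rk_add_rk_sdiff_le_of_forall_isBase hGF hFE fun B hB hFB ↦ ?_)
    rw [← charVec_mem_rankFace_iff hG.subset_ground hB]
    exact heq.superset ((charVec_mem_rankFace_iff hFE hB).2 hFB)

lemma IsSplitSet.isSplitFlacet [M.Finite] (hM : M.ConnBetween ∅ M.E) (h : M.IsSplitSet F) :
    M.IsSplitFlacet F := by
  refine ⟨h.isFlacet hM, isSplitHyperplane_hypersimplex
    (F := Subtype.val ⁻¹' F) (m := M.rk F) h.rk_pos ?_ ?_ ?_⟩
  · rw [ncard_preimage_ground h.subset_ground]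
    exact h.rk_lt_ncard
  · rw [← rk_ground_eq]
    exact h.rk_lt_rk
  · rw [← rk_ground_eq, ← Subtype.coe_preimage_self, ← Set.preimage_sdiff,
      ncard_preimage_ground Set.sdiff_subset]
    exact h.rk_ground_lt

lemma isSplitFlacet_iff [M.Finite] (hM : M.ConnBetween ∅ M.E) :
    M.IsSplitFlacet F ↔ M.IsSplitSet F :=
  ⟨fun h ↦ h.isSplitSet hM, fun h ↦ h.isSplitFlacet hM⟩

lemma isSplitMatroid_iff [M.Finite] (hM : M.ConnBetween ∅ M.E) :
    M.IsSplitMatroid ↔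
      ∀ F G, M.IsSplitSet F → M.IsSplitSet G → F ≠ G → ¬ M.MeetInside F G := by
  unfold IsSplitMatroid
  simp only [isSplitFlacet_iff hM]
  refine forall₅_congr fun F G hF hG hne ↦ ?_
  -- A split set exists here, so `0 < r(M) < |E|`, as the description of the relative interior
  -- requires.
  have h0 := hF.rk_pos.trans hF.rk_lt_rk
  have h1 := rk_lt_ncard_mono subset_rfl hF.subset_ground hF.rk_lt_ncard
  simp only [mem_intrinsicInterior_iff hM h0 h1, MeetInside, Set.mem_inter_iff,
    mem_flatHyperplane_iff]
  grind

/-! ### Proper cyclic flats -/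

lemma IsSplitSet.isConnected_restrict [M.Finite] (h : M.IsSplitSet F) :
    (M.restrict F).IsConnected :=
  (isConnected_restrict_iff h.subset_ground).2 h.conn_restrict

lemma IsSplitSet.isProperCyclicFlat [M.Finite] (h : M.IsSplitSet F) :
    M.IsProperCyclicFlat F := by
  refine ⟨h.isFlat, ?_, ?_, {C | M.IsCircuit C ∧ C ⊆ F}, fun C hC ↦ hC.1,
    Set.Subset.antisymm (fun e he ↦ ?_) (Set.sUnion_subset fun C hC ↦ hC.2)⟩
  · rw [← coe_rk]
    exact_mod_cast h.rk_pos
  · rw [← eRk_ground, ← coe_rk, ← coe_rk]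
    exact_mod_cast h.rk_lt_rk
  · have h1 := h.rk_pos
    have h2 := h.rk_lt_ncard
    obtain ⟨f, hf, hfe⟩ := Set.exists_ne_of_one_lt_ncard (by omega : 1 < F.ncard) e
    obtain ⟨C, hC, heC, -⟩ := h.isConnected_restrict e he f hf hfe.symm
    exact ⟨C, (restrict_isCircuit_iff h.subset_ground).1 hC, heC⟩

lemma IsProperCyclicFlat.rk_pos [M.Finite] (h : M.IsProperCyclicFlat Z) : 0 < M.rk Z := by
  have := h.2.1
  rw [← coe_rk] at this
  exact_mod_cast this

lemma IsProperCyclicFlat.rk_lt_rk [M.Finite] (h : M.IsProperCyclicFlat Z) :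
    M.rk Z < M.rk M.E := by
  have := h.2.2.1
  rw [← eRk_ground, ← coe_rk, ← coe_rk] at this
  exact_mod_cast this

lemma IsProperCyclicFlat.rk_lt_ncard [M.Finite] (h : M.IsProperCyclicFlat Z) :
    M.rk Z < Z.ncard := by
  have h0 := h.rk_pos
  obtain ⟨hflat, -, -, 𝒞, hC, rfl⟩ := h
  obtain ⟨e, C, hC𝒞, -⟩ : (⋃₀ 𝒞).Nonempty := by
    rw [Set.nonempty_iff_ne_empty]
    intro h
    rw [h] at h0
    simp at h0
  have := (hC C hC𝒞).rk_add_one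
  exact rk_lt_ncard_mono hflat.subset_ground (Set.subset_sUnion_of_mem hC𝒞) (by omega)

lemma IsProperCyclicFlat.isUniform_restrict [M.Finite] (hM : M.ConnBetween ∅ M.E)
    (hsplit : ∀ F G, M.IsSplitSet F → M.IsSplitSet G → F ≠ G → ¬ M.MeetInside F G)
    (hZ : M.IsProperCyclicFlat Z) (hc : (M.restrict Z).IsConnected) :
    (M.restrict Z).IsUniform :=
  isUniform_restrict_of_forall_not_meetInside hM hsplit
    ((isConnected_restrict_iff hZ.1.subset_ground).1 hc) hZ.1 hZ.rk_pos hZ.rk_lt_ncard hZ.rk_lt_rk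

lemma forall_not_meetInside_dual [M.Finite]
    (hsplit : ∀ F G, M.IsSplitSet F → M.IsSplitSet G → F ≠ G → ¬ M.MeetInside F G) :
    ∀ F G, M✶.IsSplitSet F → M✶.IsSplitSet G → F ≠ G → ¬ M✶.MeetInside F G := by
  -- The coordinate space depends on the matroid, so `M✶✶ = M` is used by substitution for a
  -- variable `N`.
  have cast : ∀ (N : Matroid α) [N.Finite] {S T : Set α}, N = M → N.MeetInside S T →
      M.MeetInside S T := by
    rintro N _ S T rfl h
    exact h
  intro F G hF hG hne hmeet
  have hF' := hF.dual
  have hG' := hG.dual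
  rw [dual_dual] at hF' hG'
  refine hsplit _ _ hF' hG' (fun h ↦ hne ?_)
    (cast M✶✶ M.dual_dual (hmeet.dual hF.subset_ground hG.subset_ground))
  rw [← Set.sdiff_sdiff_cancel_left hF.subset_ground, h,
    Set.sdiff_sdiff_cancel_left hG.subset_ground]

end Matroid

/-! ### The corollary. -/

theorem mainTheorem5 {α : Type*} (M : Matroid α) [M.Finite] (hM : M.IsConnected) :
    M.IsSplitMatroid ↔
      ∀ M' : Matroid α, M' = M ∨ M' = M.dual →
        ∀ Z : Set α, M'.IsProperCyclicFlat Z →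
          (M'.restrict Z).IsConnected → (M'.restrict Z).IsUniform := by
  rw [Matroid.isConnected_iff] at hM
  rw [Matroid.isSplitMatroid_iff hM]
  constructor
  · rintro hsplit M' (rfl | rfl) Z hZ hc
    · exact hZ.isUniform_restrict hM hsplit hc
    · have hM' := hM.dual (Set.empty_subset _) subset_rfl
      rw [Set.sdiff_self, Set.sdiff_empty] at hM'
      exact hZ.isUniform_restrict hM' (Matroid.forall_not_meetInside_dual hsplit) hc
  · intro h F G hF hG hne
    have key : ∀ S, M.IsSplitSet S → (M.restrict S).IsUniform ∧
        (M.dual.restrict (M.E \ S)).IsUniform := fun S hS ↦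
      ⟨h M (Or.inl rfl) S hS.isProperCyclicFlat hS.isConnected_restrict,
        h M.dual (Or.inr rfl) _ hS.dual.isProperCyclicFlat hS.dual.isConnected_restrict⟩
    exact Matroid.not_meetInside_of_isUniform hM hF hG hne (key F hF).1 (key G hG).1
      (key F hF).2 (key G hG).2
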